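/- Conventions. Let $A$ be a C*-algebra, $A\neq 0$, and let $uA$ be the smallest unital C*-algebra containing $A$ (that is, $A$ itself if $A$ is unital, and the standard unitization $A\oplus\mathbb{C}$ otherwise), with unit $1$. The state space $\mathscr{S}(A)$ is the set of positive linear functionals of norm $1$ on $A$; every state of $A$ is identified with its unique extension to a state of $uA$, and also with its normal extension to the enveloping von Neumann algebra $A^{**}$. We write $\mathrm{sa}(B)$ for the set of self-adjoint elements of $B$. A *Lipschitz triple* $(A,\mathsf L,M)$ consists of $A$, a seminorm $\mathsf L$ defined on a dense real subspace of $\mathrm{sa}(uA)$ (with $\mathsf L(a)=\infty$ off this subspace) such that $\{a\in \mathrm{sa}(uA):\mathsf L(a)=0\}=\mathbb{R}1$, and an Abelian C*-subalgebra $M$ of $A$ which contains an approximate identity for $A$. Let $\sigma(M)$ be the Gel'fand spectrum of $M$ and, for compact $K\subseteq\sigma(M)$, let $\chi_K\in M^{**}\subseteq A^{**}$ be the indicator function of $K$. Set $\mathscr{S}(A|K)=\{\varphi\in\mathscr{S}(A):\varphi(\chi_K)=1\}$. A *local state* is an element of $\mathscr{S}(A|M)=\bigcup_K\mathscr{S}(A|K)$,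 where $K$ ranges over the compact subsets of $\sigma(M)$. For $\mu\in\mathscr{S}(A)$ put $$\mathfrak{L}_1(A,\mathsf L,\mu)=\{a\in \mathrm{sa}(uA): \mathsf L(a)\le 1,\ \mu(a)=0\},$$ and for $\varphi,\psi\in\mathscr{S}(A)$ put $$\mathrm{mk}_{\mathsf L}(\varphi,\psi)=\sup\{|\varphi(a)-\psi(a)| : a\in \mathrm{sa}(A),\ \mathsf L(a)\le 1\}\in[0,\infty].$$ A set $\mathscr{K}\subseteq\mathscr{S}(A)$ is *tame* if for some local state $\mu$, $$\lim_{K}\ \sup\{|\varphi(a-\chi_Ka\chi_K)| : a\in\mathfrak{L}_1(A,\mathsf L,\mu),\ \varphi\in\mathscr{K}\}=0,$$ the limit being along the compact subsets $K$ of $\sigma(M)$ directed by inclusion. The triple is *regular* if $\mathscr{S}(A|K)$ has finite diameter for $\mathrm{mk}_{\mathsf L}$ for every compact $K\subseteq\sigma(M)$. It is a *quantum locally compact metric space* if it is regular and, on every tame set $\mathscr{K}$, the topology of $\mathrm{mk}_{\mathsf L}$ is the relative weak* topology $\sigma(A^*,A)$; it is a *quantum locally compact separable metric space* if moreover $A$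 is separable. An element $h\geq 0$ of $M$ is *strictly positive* if $\psi(h)>0$ for every nonzero positive linear functional $\psi$ on $M$. Theorem. Let $(A,\mathsf L,M)$ be a Lipschitz triple where $A\neq 0$ is separable. The following assertions are equivalent: 1. $(A,\mathsf L,M)$ is a quantum locally compact separable metric space; 2. there exists a strictly positive element $h\in M$ such that for all local states $\mu\in\mathscr{S}(A|M)$ the set $h\,\mathfrak{L}_1(A,\mathsf L,\mu)\,h$ is totally bounded for the norm of $uA$; 3. there exist a strictly positive element $h\in M$ and a local state $\mu\in\mathscr{S}(A|M)$ such that $h\,\mathfrak{L}_1(A,\mathsf L,\mu)\,h$ is totally bounded for the norm of $uA$. -/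

import Mathlib

open Filter Topology
open scoped ComplexOrder ENNReal

namespace QuantumLCMS

noncomputable section

/-! ### The smallest unitization of a C⋆-algebra -/

/-- The smallest unital C⋆-algebra `uA` containing the C⋆-algebra `A`, realised inside the
multiplier algebra `𝓜(ℂ, A)` as `A + ℂ1`. It is (a copy of) `A` when `A` has a unit, and the standard
unitization `A ⊕ ℂ` (with its C⋆-norm) otherwise. -/
def MinUnitization (A : Type*) [NonUnitalCStarAlgebra A] :
    StarSubalgebra ℂ (DoubleCentralizer ℂ A) where
  carrier := {x | ∃ (a : A) (c : ℂ), x = DoubleCentralizer.coeHom (𝕜 := ℂ) a + algebraMap ℂ _ c}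
  mul_mem' := by
    rintro _ _ ⟨a, c, rfl⟩ ⟨b, d, rfl⟩
    refine ⟨a * b + d • a + c • b, c * d, ?_⟩
    simp only [map_add, map_mul, map_smul, Algebra.algebraMap_eq_smul_one, add_mul, mul_add,
      smul_mul_assoc, mul_smul_comm, one_mul, mul_one, smul_smul]
    rw [mul_comm d c]
    simp only [mul_comm, smul_add, smul_smul]
    abel
  add_mem' := by
    rintro _ _ ⟨a, c, rfl⟩ ⟨b, d, rfl⟩
    refine ⟨a + b, c + d, ?_⟩
    simp only [map_add]
    abel
  algebraMap_mem' c := ⟨0, c, by rw [map_zero, zero_add]⟩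
  star_mem' := by
    rintro _ ⟨a, c, rfl⟩
    exact ⟨star a, star c, by rw [star_add, map_star, algebraMap_star_comm]⟩

/-- The (isometric) inclusion of `A` in its smallest unitization `uA`. -/
def incl (A : Type*) [NonUnitalCStarAlgebra A] : A →ₗᵢ[ℂ] MinUnitization A where
  toFun a := ⟨DoubleCentralizer.coeHom (𝕜 := ℂ) a, a, 0, by rw [map_zero, add_zero]⟩
  map_add' a b := Subtype.ext (map_add _ a b)
  map_smul' c a := Subtype.ext (map_smul (DoubleCentralizer.coeHom (𝕜 := ℂ)) c a)
  norm_map' a := by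
    change ‖DoubleCentralizer.coeHom (𝕜 := ℂ) a‖ = ‖a‖
    rw [← DoubleCentralizer.norm_fst]
    exact ContinuousLinearMap.opNorm_mul_apply ℂ A a

/-! ### States -/

/-- A state of `A`, identified with its unique extension to a state of the smallest unitization
`uA`: a positive linear functional `φ` on `uA` with `φ 1 = 1` whose restriction to `A` has norm one.
(The restriction map is a bijection onto the set of positive functionals of norm one on `A`.) -/
def State (A : Type*) [NonUnitalCStarAlgebra A] : Type _ :=
  {φ : StrongDual ℂ (MinUnitization A) //
    (∀ b, 0 ≤ φ (star b * b)) ∧ φ 1 = 1 ∧ ‖φ.comp (incl A).toContinuousLinearMap‖ = 1}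

/-- The weak* topology `σ(A*, A)` on the state space of `A`. -/
abbrev weakStarTopology (A : Type*) [NonUnitalCStarAlgebra A] : TopologicalSpace (State A) :=
  TopologicalSpace.induced (fun φ (a : A) => φ.1 (incl A a)) inferInstance

/-! ### Lipschitz pairs -/

/-- The seminorm `L` of a Lipschitz pair `(A, L)`: a seminorm on a dense real subspace of the space
of self-adjoint elements of `uA` (with `L = ∞` off this subspace), which vanishes exactly on the
real multiples of the unit. -/
structure LipschitzSeminorm (A : Type*) [NonUnitalCStarAlgebra A] where
  domain : Submodule ℝ (selfAdjoint (MinUnitization A))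
  dense_domain : Dense (domain : Set (selfAdjoint (MinUnitization A)))
  seminorm : Seminorm ℝ domain
  seminorm_eq_zero_iff : ∀ a : selfAdjoint (MinUnitization A),
    (∃ h : a ∈ domain, seminorm ⟨a, h⟩ = 0) ↔ ∃ r : ℝ, a = r • 1

namespace LipschitzSeminorm

variable {A : Type*} [NonUnitalCStarAlgebra A] (L : LipschitzSeminorm A)

/-- `{a ∈ sa(uA) : L(a) ≤ 1}`, as a subset of `uA`. -/
def unitBall : Set (MinUnitization A) :=
  {b | ∃ (a : selfAdjoint (MinUnitization A)) (h : a ∈ L.domain), L.seminorm ⟨a, h⟩ ≤ 1 ∧ (a : _) = b}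

/-- `𝔏₁(A, L, μ) = {a ∈ sa(uA) : L(a) ≤ 1 and μ(a) = 0}`. -/
def ballAt (μ : State A) : Set (MinUnitization A) := {b ∈ L.unitBall | μ.1 b = 0}

/-- The extended Monge-Kantorovich metric:
`mk_L(φ, ψ) = sup {|φ(a) - ψ(a)| : a ∈ sa(A), L(a) ≤ 1}`. -/
def dist (φ ψ : State A) : ℝ≥0∞ :=
  ⨆ b ∈ {b ∈ L.unitBall | b ∈ Set.range (incl A)}, ‖φ.1 b - ψ.1 b‖ₑ

/-- The extended metric space structure on the state space given by `mk_L`. -/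
abbrev mkEMetric : PseudoEMetricSpace (State A) where
  edist := L.dist
  edist_self φ := by simp [dist]
  edist_comm φ ψ := by simp only [dist, ← edist_eq_enorm_sub, edist_comm]
  edist_triangle φ ψ χ := by
    refine iSup₂_le fun b hb => ?_
    rw [← edist_eq_enorm_sub]
    refine (edist_triangle _ (ψ.1 b) _).trans ?_
    rw [edist_eq_enorm_sub, edist_eq_enorm_sub]
    exact add_le_add (le_iSup₂ (f := fun b _ => ‖φ.1 b - ψ.1 b‖ₑ) b hb)
      (le_iSup₂ (f := fun b _ => ‖ψ.1 b - χ.1 b‖ₑ) b hb)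

/-- The topology on the state space induced by the extended metric `mk_L`. -/
abbrev mkTopology : TopologicalSpace (State A) := L.mkEMetric.toUniformSpace.toTopologicalSpace

end LipschitzSeminorm

/-! ### Topographies -/

/-- A topography of `A`: an Abelian C⋆-subalgebra of `A` which contains an approximate identity
for `A`. -/
structure Topography (A : Type*) [NonUnitalCStarAlgebra A] where
  alg : NonUnitalStarSubalgebra ℂ A
  isClosed : IsClosed (alg : Set A)
  mul_comm : ∀ a ∈ alg, ∀ b ∈ alg, a * b = b * a
  exists_approximateUnit : ∃ l : Filter A, l.IsApproximateUnit ∧ (alg : Set A) ∈ l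

/-- A strictly positive element of a C⋆-algebra `M`: a positive element at which every nonzero
positive linear functional takes a positive value. -/
def StrictlyPositiveElement {M : Type*} [NonUnitalNormedRing M] [StarRing M] [NormedSpace ℂ M]
    (h : M) : Prop :=
  (∃ k : M, h = star k * k) ∧
    ∀ ψ : StrongDual ℂ M, (∀ m, 0 ≤ ψ (star m * m)) → ψ ≠ 0 → 0 < ψ h

/-! ### The bidual -/

/-- The topological bidual of a normed algebra. For a C⋆-algebra with the product `arensMul` this is
its enveloping von Neumann algebra. -/
abbrev Bidual (B : Type*) [NormedRing B] [NormedAlgebra ℂ B] := StrongDual ℂ (StrongDual ℂ B)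

/-- The (first Arens) product of the bidual, extending the product of `B`:
`(Φ Ψ)(φ) = Φ (x ↦ Ψ (y ↦ φ (x y)))`. -/
def arensMul {B : Type*} [NormedRing B] [NormedAlgebra ℂ B] (Φ Ψ : Bidual B) : Bidual B :=
  Φ.comp ((ContinuousLinearMap.compL ℂ B (StrongDual ℂ B) ℂ Ψ).comp
    (((ContinuousLinearMap.compL ℂ B (B →L[ℂ] B) (StrongDual ℂ B)).flip
      (ContinuousLinearMap.mul ℂ B)).comp (ContinuousLinearMap.compL ℂ B B ℂ)))

theorem arensMul_apply {B : Type*} [NormedRing B] [NormedAlgebra ℂ B] (Φ Ψ : Bidual B)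
    (φ : StrongDual ℂ B) :
    arensMul Φ Ψ φ = Φ (Ψ.comp ((ContinuousLinearMap.compL ℂ B B ℂ φ).comp
      (ContinuousLinearMap.mul ℂ B))) := rfl

namespace Topography

variable {A : Type*} [NonUnitalCStarAlgebra A] (M : Topography A)

/-- The Gel'fand spectrum `σ(M)`, with the weak* topology. -/
abbrev spec : Type _ := WeakDual.characterSpace ℂ M.alg

variable [PartialOrder A] [StarOrderedRing A]

/-- For `K ⊆ σ(M)` compact, the elements `0 ≤ f ≤ 1` of `M` whose Gel'fand transform is `1` on `K`. -/
def Majorant (K : TopologicalSpace.Compacts M.spec) : Type _ :=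
  {f : M.alg // 0 ≤ (f : A) ∧ ‖f‖ ≤ 1 ∧ ∀ x ∈ K, x f = 1}

/-- Majorants of `1_K` are ordered downwards: `f ≤ g` in this order when `g ≤ f` in `M`. -/
instance (K : TopologicalSpace.Compacts M.spec) : Preorder (M.Majorant K) where
  le f g := (g.1 : A) ≤ (f.1 : A)
  le_refl _ := le_refl (_ : A)
  le_trans _ _ _ h₁ h₂ := le_trans (α := A) h₂ h₁

instance (K : TopologicalSpace.Compacts M.spec) : IsDirectedOrder (M.Majorant K) where
  directed := by
    have key : ∀ f g : M.Majorant K, (f.1 : A) * (g.1 : A) ≤ f.1 := by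
      intro f g
      have hc : Commute (g.1 : A) (f.1 : A) := M.mul_comm _ g.1.2 _ f.1.2
      have hs : Commute (g.1 : A) (CFC.sqrt (f.1 : A)) :=
        (hc.symm.cfcₙ_nnreal (f := NNReal.sqrt)).symm
      have hsa : star (CFC.sqrt (f.1 : A)) = CFC.sqrt (f.1 : A) :=
        (IsSelfAdjoint.of_nonneg (CFC.sqrt_nonneg _)).star_eq
      have h1 := CStarAlgebra.star_left_conjugate_le_norm_smul (a := CFC.sqrt (f.1 : A))
        (b := (g.1 : A)) (IsSelfAdjoint.of_nonneg g.2.1)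
      have hf := CFC.sqrt_mul_sqrt_self (f.1 : A) f.2.1
      rw [hsa, mul_assoc, hs.eq, ← mul_assoc, hf] at h1
      refine h1.trans ?_
      have h2 : ‖(g.1 : A)‖ ≤ 1 := g.2.2.1
      calc ‖(g.1 : A)‖ • (f.1 : A) ≤ (1 : ℝ) • (f.1 : A) :=
            smul_le_smul_of_nonneg_right h2 f.2.1
        _ = f.1 := one_smul _ _
    intro f g
    refine ⟨⟨f.1 * g.1, ?_, ?_, ?_⟩, key f g, ?_⟩
    · exact Commute.mul_nonneg f.2.1 g.2.1 (M.mul_comm _ f.1.2 _ g.1.2)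
    · exact (norm_mul_le _ _).trans (mul_le_one₀ f.2.2.1 (norm_nonneg _) g.2.2.1)
    · intro x hx
      have : x (f.1 * g.1) = x f.1 * x g.1 := x.2.2 _ _
      rw [this, f.2.2.2 x hx, g.2.2.2 x hx, one_mul]
    · have := key g f
      rwa [M.mul_comm _ g.1.2 _ f.1.2] at this

/-- A bounded real functional oscillates downwards by less than `δ` far along the majorants. -/
theorem exists_forall_sub_lt (K : TopologicalSpace.Compacts M.spec) [Nonempty (M.Majorant K)]
    (ψ : A →L[ℝ] ℝ) {δ : ℝ} (hδ : 0 < δ) :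
    ∃ f₀ : M.Majorant K, ∀ g, f₀ ≤ g → ∀ k, g ≤ k → ψ g.1 - ψ k.1 < δ := by
  by_contra! H
  obtain ⟨f₀⟩ := ‹Nonempty (M.Majorant K)›
  have hind : ∀ n : ℕ, ∃ (k : M.Majorant K) (s : A),
      0 ≤ s ∧ s ≤ (f₀.1 : A) - k.1 ∧ n * δ ≤ ψ s := by
    intro n
    induction n with
    | zero => exact ⟨f₀, 0, le_rfl, by simp, by simp⟩
    | succ n ih =>
      obtain ⟨k, s, hs0, hs, hψ⟩ := ih
      obtain ⟨g, hg, k', hk', h⟩ := H k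
      have hg' : (g.1 : A) ≤ k.1 := hg
      have hk'' : (k'.1 : A) ≤ g.1 := hk'
      refine ⟨k', s + ((g.1 : A) - k'.1), add_nonneg hs0 (sub_nonneg.2 hk''), ?_, ?_⟩
      · calc s + ((g.1 : A) - k'.1) ≤ ((f₀.1 : A) - k.1) + ((k.1 : A) - k'.1) :=
              add_le_add hs (sub_le_sub_right hg' _)
          _ = (f₀.1 : A) - k'.1 := by abel
      · rw [map_add, map_sub]
        push_cast
        linarith
  obtain ⟨n, hn⟩ := exists_nat_gt (‖ψ‖ / δ)
  obtain ⟨k, s, hs0, hs, hψ⟩ := hind n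
  have h1 : ‖s‖ ≤ 1 :=
    (CStarAlgebra.norm_le_norm_of_nonneg_of_le hs0
      (hs.trans (sub_le_self _ k.2.1))).trans f₀.2.2.1
  have h2 : ψ s ≤ ‖ψ‖ :=
    (le_abs_self _).trans ((ψ.le_opNorm s).trans (mul_le_of_le_one_right (norm_nonneg _) h1))
  rw [div_lt_iff₀ hδ] at hn
  linarith

theorem exists_tendsto_real (K : TopologicalSpace.Compacts M.spec) (ψ : A →L[ℝ] ℝ) :
    ∃ l : ℝ, Tendsto (fun f : M.Majorant K => ψ (f.1 : A)) atTop (𝓝 l) := by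
  rcases isEmpty_or_nonempty (M.Majorant K) with hK | hK
  · exact ⟨0, by rw [filter_eq_bot_of_isEmpty atTop]; exact tendsto_bot⟩
  · suffices h : Cauchy (Filter.map (fun f : M.Majorant K => ψ (f.1 : A)) atTop) from
      CompleteSpace.complete h
    rw [Metric.cauchy_iff]
    refine ⟨inferInstance, fun ε hε => ?_⟩
    obtain ⟨f₁, h₁⟩ := M.exists_forall_sub_lt K ψ (half_pos hε)
    obtain ⟨f₂, h₂⟩ := M.exists_forall_sub_lt K (-ψ) (half_pos hε)
    obtain ⟨f, hf₁, hf₂⟩ := exists_ge_ge f₁ f₂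
    refine ⟨_, image_mem_map (Ici_mem_atTop f), ?_⟩
    have hd : ∀ g, f ≤ g → |ψ (g.1 : A) - ψ (f.1 : A)| < ε / 2 := by
      intro g hg
      have a := h₁ f hf₁ g hg
      have b := h₂ f hf₂ g hg
      simp only [neg_apply] at b
      rw [abs_lt]
      constructor <;> linarith
    rintro _ ⟨g, hg, rfl⟩ _ ⟨k, hk, rfl⟩
    have a := abs_lt.1 (hd g hg)
    have b := abs_lt.1 (hd k hk)
    rw [Real.dist_eq, abs_lt]
    constructor <;> linarith

theorem exists_tendsto (K : TopologicalSpace.Compacts M.spec)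
    (φ : StrongDual ℂ (MinUnitization A)) :
    ∃ l : ℂ, Tendsto (fun f : M.Majorant K => φ (incl A f.1)) atTop (𝓝 l) := by
  let ψ : A →L[ℝ] ℂ := (φ.comp (incl A).toContinuousLinearMap).restrictScalars ℝ
  obtain ⟨r, hr⟩ := M.exists_tendsto_real K (Complex.reCLM.comp ψ)
  obtain ⟨s, hs⟩ := M.exists_tendsto_real K (Complex.imCLM.comp ψ)
  refine ⟨r + s * Complex.I, ?_⟩
  have h := ((Complex.continuous_ofReal.tendsto r).comp hr).add
    (((Complex.continuous_ofReal.tendsto s).comp hs).mul_const Complex.I)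
  refine h.congr fun f => ?_
  exact Complex.re_add_im _

/-- The weak* limit of the majorants of `1_K` exists in the bidual. -/
theorem exists_indicator (K : TopologicalSpace.Compacts M.spec) :
    ∃ p : Bidual (MinUnitization A), ∀ φ : StrongDual ℂ (MinUnitization A),
      Tendsto (fun f : M.Majorant K => φ (incl A f.1)) atTop (𝓝 (p φ)) := by
  rcases isEmpty_or_nonempty (M.Majorant K) with hK | hK
  · exact ⟨0, fun φ => by rw [filter_eq_bot_of_isEmpty atTop]; exact tendsto_bot⟩
  · choose p hp using M.exists_tendsto K
    refine ⟨LinearMap.mkContinuous ⟨⟨p, fun φ ψ => ?_⟩, fun c φ => ?_⟩ 1 fun φ => ?_, hp⟩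
    · exact tendsto_nhds_unique (hp (φ + ψ)) ((hp φ).add (hp ψ))
    · exact tendsto_nhds_unique (hp (c • φ)) ((hp φ).const_mul c)
    · refine le_of_tendsto (hp φ).norm (Eventually.of_forall fun f => ?_)
      refine (φ.le_opNorm _).trans ?_
      rw [(incl A).norm_map, one_mul]
      exact mul_le_of_le_one_right (norm_nonneg _) f.2.2.1

/-- The projection `1_K ∈ M** ⊆ A** ⊆ (uA)**` for `K ⊆ σ(M)` compact: the weak* limit in the bidual of
the decreasing net of all `f ∈ M` with `0 ≤ f ≤ 1` and `f = 1` on `K`. For a state `φ`, outer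
regularity says that `φ(1_K) = inf_f φ(f)` is the measure of `K` for the Radon probability measure on
`σ(M)` which represents the restriction of `φ` to `M`. -/
def indicator (K : TopologicalSpace.Compacts M.spec) : Bidual (MinUnitization A) :=
  (M.exists_indicator K).choose

theorem tendsto_indicator (K : TopologicalSpace.Compacts M.spec)
    (φ : StrongDual ℂ (MinUnitization A)) :
    Tendsto (fun f : M.Majorant K => φ (incl A f.1)) atTop (𝓝 (M.indicator K φ)) :=
  (M.exists_indicator K).choose_spec φ

/-- `1_K a 1_K`, computed in the bidual, for `a ∈ uA`. -/
def corner (K : TopologicalSpace.Compacts M.spec) (a : MinUnitization A) :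
    Bidual (MinUnitization A) :=
  arensMul (M.indicator K)
    (arensMul (NormedSpace.inclusionInDoubleDual ℂ (MinUnitization A) a) (M.indicator K))

/-- `𝒮(A|K)`: the states `φ` of `A` with `φ(1_K) = 1`. -/
def statesOn (K : TopologicalSpace.Compacts M.spec) : Set (State A) :=
  {φ | M.indicator K φ.1 = 1}

/-- The local state space `𝒮(A|M)`. -/
def localStates : Set (State A) := ⋃ K, M.statesOn K

end Topography

/-! ### Quantum locally compact metric spaces -/

section Triple

variable {A : Type*} [NonUnitalCStarAlgebra A] [PartialOrder A] [StarOrderedRing A]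
  (L : LipschitzSeminorm A) (M : Topography A)

/-- Tame sets of states of the Lipschitz triple `(A, L, M)`: for some local state `μ`,
`sup {|φ(a - 1_K a 1_K)| : a ∈ 𝔏₁(A, L, μ), φ ∈ S} → 0` along the compact subsets `K` of `σ(M)`, directed
by inclusion. -/
def IsTame (S : Set (State A)) : Prop :=
  ∃ μ ∈ M.localStates, Tendsto
    (fun K : TopologicalSpace.Compacts M.spec =>
      ⨆ φ ∈ S, ⨆ a ∈ L.ballAt μ, ‖φ.1 a - M.corner K a φ.1‖ₑ) atTop (𝓝 0)

/-- A Lipschitz triple is regular when each `𝒮(A|K)` has finite diameter for `mk_L`. -/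
def IsRegular : Prop :=
  ∀ K : TopologicalSpace.Compacts M.spec,
    (⨆ φ ∈ M.statesOn K, ⨆ ψ ∈ M.statesOn K, L.dist φ ψ) < ⊤

/-- `(A, L, M)` is a quantum locally compact metric space: it is regular, and on each tame set of
states the topology of `mk_L` is the relative weak* topology. -/
def IsQuantumLocallyCompactMetricSpace : Prop :=
  IsRegular L M ∧ ∀ S : Set (State A), IsTame L M S →
    TopologicalSpace.induced ((↑) : S → State A) L.mkTopology =
      TopologicalSpace.induced ((↑) : S → State A) (weakStarTopology A)

/-- A quantum locally compact separable metric space. -/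
def IsQuantumLocallyCompactSeparableMetricSpace : Prop :=
  IsQuantumLocallyCompactMetricSpace L M ∧ TopologicalSpace.SeparableSpace A

end Triple

end

end QuantumLCMS

/-! The link between the two sides is that, for self-adjoint `f ∈ M` supported in a compact `K`, the
norm of `f a f` is at most `‖f‖²` times the supremum of `|φ(a)|` over `𝒮(A|K)` (`norm_mul_mul_le`).
This holds because a state norming `f a f` compresses to `ψ(f · f) / ψ(f²)`, a state in `𝒮(A|K)`.

From total boundedness to the metric: a strictly positive `h` has positive values on the spectrum,
hence is bounded below on compact sets. A ramp function `f` of `h` vanishing near `0` is a multiple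
of `h`, so `f 𝔏₁ f` is totally bounded as well. States in `𝒮(A|K)` do not see multiplication by a
majorant of `1_K`, which gives regularity. On a tame set, `φ(a)` is uniformly close to `φ(1_K a
1_K)`. Cauchy-Schwarz replaces `1_K` by a ramp `f₂` at a cost governed by `φ(f₂ - f₁)`, with `f₁`
the next ramp. Among many successive ramps, pigeonhole finds one where this drop is small for a
given `φ`, and smallness persists for weak* nearby states. Since `f₂ 𝔏₁ f₂` is a totally bounded
subset of `A`, finitely many elements of `A` then control `mk_L` near `φ`
(`exists_finset_of_isTame`). That `mk_L` refines the weak* topology is always true, by density of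
the domain of `L`.

From the metric to total boundedness: `𝒮(A|K)` is weak* compact and trivially tame, so it is compact
for `mk_L` and has finite `ε`-nets. Evaluation on such a net sends `𝔏₁` to a bounded set in finite
dimension, and the norm estimate above makes `f 𝔏₁ f` totally bounded
(`totallyBounded_of_supportedIn`). Separability supplies a strictly positive `h`. A series `k = ∑ cₙ
fₙ` of cutoffs of `h`, with `cₙ` decreasing fast enough, is still strictly positive, and `k a k` is
a limit, uniform in `a ∈ 𝔏₁`, of compressions by compactly supported elements.

The base point is immaterial: changing `μ` moves elements of `𝔏₁` by uniformly bounded scalars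
(`totallyBounded_ballAt_change`). -/

namespace QuantumLCMS

noncomputable section

/-! ### Cauchy-Schwarz for positive functionals -/

section Functional

/-- A linear functional is positive if it is nonnegative at all `star b * b`. -/
def IsPositiveFunctional {B : Type*} [NonUnitalRing B] [StarRing B] [Module ℂ B]
    (φ : B →ₗ[ℂ] ℂ) : Prop :=
  ∀ b, 0 ≤ φ (star b * b)

namespace IsPositiveFunctional

variable {B : Type*} [NonUnitalRing B] [StarRing B] [Module ℂ B] [StarModule ℂ B]
  [IsScalarTower ℂ B B] [SMulCommClass ℂ B B] {φ : B →ₗ[ℂ] ℂ}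

/-- Polarization: `φ` is real on the squares of `x + y` and `x + iy`. -/
theorem conj_apply (hφ : IsPositiveFunctional φ) (x y : B) :
    (starRingEnd ℂ) (φ (star y * x)) = φ (star x * y) := by
  have h1 := (Complex.nonneg_iff.1 (hφ (x + y))).2
  have h2 := (Complex.nonneg_iff.1 (hφ (x + Complex.I • y))).2
  have hx := (Complex.nonneg_iff.1 (hφ x)).2
  have hy := (Complex.nonneg_iff.1 (hφ y)).2
  simp only [star_add, star_smul, add_mul, mul_add, smul_mul_assoc, mul_smul_comm, map_add,
    map_smul, smul_eq_mul, Complex.add_im, Complex.star_def, Complex.conj_I, Complex.mul_im,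
    Complex.mul_re, Complex.I_re, Complex.I_im, Complex.neg_re, Complex.neg_im] at h1 h2
  apply Complex.ext
  · simp only [Complex.conj_re]; linarith
  · simp only [Complex.conj_im]; linarith

theorem norm_sq_le (hφ : IsPositiveFunctional φ) (x y : B) :
    ‖φ (star x * y)‖ ^ 2 ≤ (φ (star x * x)).re * (φ (star y * y)).re := by
  let c : PreInnerProductSpace.Core ℂ B :=
    { inner := fun x y => φ (star x * y)
      conj_inner_symm := fun x y => hφ.conj_apply x y
      re_inner_nonneg := fun x => (Complex.nonneg_iff.1 (hφ x)).1
      add_left := fun x y z => by simp [add_mul]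
      smul_left := fun x y r => by simp [smul_mul_assoc] }
  have h := InnerProductSpace.Core.inner_mul_inner_self_le (𝕜 := ℂ) x y
  have h2 : ‖φ (star y * x)‖ = ‖φ (star x * y)‖ := by
    rw [← hφ.conj_apply x y, Complex.norm_conj]
  calc ‖φ (star x * y)‖ ^ 2 = ‖φ (star x * y)‖ * ‖φ (star y * x)‖ := by rw [h2, sq]
    _ ≤ _ := h

end IsPositiveFunctional

end Functional

/-! ### Characters and functional calculus without a unit -/

section Characters

variable {B : Type*} [NonUnitalCStarAlgebra B]

open WeakDual

theorem character_map_star (x : characterSpace ℂ B) (b : B) : x (star b) = star (x b) := by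
  have h := map_star (Unitization.lift (CharacterSpace.toNonUnitalAlgHom x)) (b : Unitization ℂ B)
  rw [← Unitization.inr_star] at h
  simpa using h

/-- A character of a C⋆-algebra, as a star homomorphism. -/
def characterHom (x : characterSpace ℂ B) : B →⋆ₙₐ[ℂ] ℂ :=
  { CharacterSpace.toNonUnitalAlgHom x with map_star' := character_map_star x }

@[simp] theorem characterHom_apply (x : characterSpace ℂ B) (b : B) : characterHom x b = x b := rfl

theorem norm_character_le (x : characterSpace ℂ B) (b : B) : ‖x b‖ ≤ ‖b‖ :=
  NonUnitalStarAlgHom.norm_apply_le (characterHom x) b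

theorem character_star_mul_self (x : characterSpace ℂ B) (b : B) :
    x (star b * b) = (‖x b‖ ^ 2 : ℝ) := by
  have h : x (star b * b) = x (star b) * x b := x.2.2 _ _
  rw [h, character_map_star, Complex.star_def, Complex.conj_mul']
  push_cast
  rfl

/-- The Gelfand transform of the unitization is isometric, and a character of the unitization not
vanishing at `b` restricts to a character of `B`. -/
theorem eq_zero_of_character_eq_zero (hcomm : ∀ a b : B, a * b = b * a) {b : B}
    (hb : ∀ x : characterSpace ℂ B, x b = 0) : b = 0 := by
  let _ : NonUnitalCommCStarAlgebra B := { ‹NonUnitalCStarAlgebra B› with mul_comm := hcomm }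
  suffices h : WeakDual.gelfandTransform ℂ (Unitization ℂ B) (b : Unitization ℂ B) = 0 by
    have h2 := (gelfandTransform_isometry (Unitization ℂ B)).injective (h.trans (map_zero _).symm)
    exact Unitization.inr_injective (h2.trans (Unitization.inr_zero ℂ).symm)
  ext y
  change y (b : Unitization ℂ B) = 0
  by_contra hy
  let f : B →ₙₐ[ℂ] ℂ :=
    (CharacterSpace.toAlgHom y : Unitization ℂ B →ₙₐ[ℂ] ℂ).comp (Unitization.inrNonUnitalAlgHom ℂ B)
  have hf : ∀ c : B, f c = y (c : Unitization ℂ B) := fun c => rfl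
  have hc : Continuous f := (map_continuous y).comp (by
    exact Unitization.continuous_inr)
  let x : WeakDual ℂ B := (⟨⟨⟨f, map_add f⟩, map_smul f⟩, hc⟩ : B →L[ℂ] ℂ)
  have hx : x ∈ characterSpace ℂ B := ⟨fun h0 => hy (by
    have := congrArg (fun z : WeakDual ℂ B => z b) h0
    exact this), fun a c => map_mul f a c⟩
  exact hy (hb ⟨x, hx⟩)

theorem character_cfcₙ (x : characterSpace ℂ B) {h : B} (hh : IsSelfAdjoint h) {F : ℝ → ℝ}
    (hF : Continuous F) (hF0 : F 0 = 0) : x (cfcₙ F h) = F (x h).re := by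
  have hr : ((x h).re : ℂ) = x h := by
    rw [← Complex.conj_eq_iff_re, ← Complex.star_def, ← character_map_star, hh.star_eq]
  have h1 := NonUnitalStarAlgHom.map_cfcₙ (R := ℝ) (S := ℂ) (characterHom x) F h
    hF.continuousOn hF0 (ContinuousLinearMap.continuous (x : WeakDual ℂ B).toStrongDual) hh
    (hh.map (characterHom x))
  rw [characterHom_apply, characterHom_apply, ← hr, cfcₙ_eq_cfc hF.continuousOn hF0] at h1
  rw [h1]
  exact cfc_algebraMap (A := ℂ) (x h).re F

end Characters

/-! ### Norming states of self-adjoint elements -/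

section HahnBanach

variable {U : Type*} [CStarAlgebra U]

/-- The C⋆-identity gives `‖b + it‖² ≤ ‖b‖² + t²`, while a nonzero imaginary part of `ψ b` would add
a term linear in `t` on the left. -/
theorem im_eq_zero_of_norm_le_one {ψ : StrongDual ℂ U} (hψ : ‖ψ‖ ≤ 1) (h1 : ψ 1 = 1) {b : U}
    (hb : IsSelfAdjoint b) : (ψ b).im = 0 := by
  have : Nontrivial U := ⟨⟨1, 0, fun h => by rw [h, map_zero] at h1; exact zero_ne_one h1⟩⟩
  have key : ∀ t : ℝ, ((ψ b).im + t) ^ 2 ≤ ‖b‖ ^ 2 + t ^ 2 := by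
    intro t
    have h2 : ‖ψ (b + (t * Complex.I) • 1)‖ ≤ ‖b + (t * Complex.I) • (1 : U)‖ :=
      (ψ.le_opNorm _).trans (mul_le_of_le_one_left (norm_nonneg _) hψ)
    have h3 : star (b + (t * Complex.I) • (1 : U)) * (b + (t * Complex.I) • (1 : U)) =
        star b * b + ((t ^ 2 : ℝ) : ℂ) • 1 := by
      have e : (-((t : ℂ) * Complex.I)) * (t * Complex.I) = ((t ^ 2 : ℝ) : ℂ) := by
        push_cast
        linear_combination (-(t : ℂ) ^ 2) * Complex.I_mul_I
      simp only [star_add, star_smul, star_one, hb.star_eq, add_mul, mul_add, smul_mul_assoc,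
        mul_smul_comm, one_mul, mul_one, Complex.star_def, map_mul, Complex.conj_ofReal,
        Complex.conj_I]
      rw [← e]
      module
    have h4 : ‖b + (t * Complex.I) • (1 : U)‖ ^ 2 ≤ ‖b‖ ^ 2 + t ^ 2 := by
      rw [sq, ← CStarRing.norm_star_mul_self, h3]
      refine (norm_add_le _ _).trans ?_
      rw [CStarRing.norm_star_mul_self, norm_smul, CStarRing.norm_one, Complex.norm_real,
        Real.norm_of_nonneg (sq_nonneg t), mul_one, sq ‖b‖]
    have h5 : (ψ (b + (t * Complex.I) • 1)).im = (ψ b).im + t := by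
      simp [h1]
    rw [← h5]
    calc _ ≤ ‖ψ (b + (t * Complex.I) • 1)‖ ^ 2 := by
          rw [← sq_abs]
          exact pow_le_pow_left₀ (abs_nonneg _) (Complex.abs_im_le_norm _) 2
      _ ≤ _ := (pow_le_pow_left₀ (norm_nonneg _) h2 2).trans h4
  by_contra h0
  have h6 := key ((‖b‖ ^ 2 + 1) / (ψ b).im)
  have h7 : (ψ b).im * ((‖b‖ ^ 2 + 1) / (ψ b).im) = ‖b‖ ^ 2 + 1 := by field_simp
  nlinarith [sq_nonneg (ψ b).im, sq_nonneg ‖b‖]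

/-- With `r = ‖b⋆b‖`, the element `r - b⋆b` has norm at most `r`, so `r - ψ(b⋆b) ≤ r`. -/
theorem nonneg_of_norm_le_one {ψ : StrongDual ℂ U} (hψ : ‖ψ‖ ≤ 1) (h1 : ψ 1 = 1) (b : U) :
    0 ≤ ψ (star b * b) := by
  let _ := CStarAlgebra.spectralOrder U
  have _ := CStarAlgebra.spectralOrderedRing U
  have : Nontrivial U := ⟨⟨1, 0, fun h => by rw [h, map_zero] at h1; exact zero_ne_one h1⟩⟩
  have hs : IsSelfAdjoint (star b * b) := .star_mul_self b
  have h2 : ‖algebraMap ℝ U ‖star b * b‖ - star b * b‖ ≤ ‖star b * b‖ := by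
    refine (CStarAlgebra.norm_le_norm_of_nonneg_of_le
      (sub_nonneg.2 hs.le_algebraMap_norm_self) (sub_le_self _ (star_mul_self_nonneg b))).trans ?_
    rw [norm_algebraMap', norm_norm]
  rw [Complex.nonneg_iff]
  refine ⟨?_, (im_eq_zero_of_norm_le_one hψ h1 hs).symm⟩
  have h3 : ψ (algebraMap ℝ U ‖star b * b‖ - star b * b) = ‖star b * b‖ - ψ (star b * b) := by
    rw [map_sub, IsScalarTower.algebraMap_apply ℝ ℂ U, Algebra.algebraMap_eq_smul_one (A := U),
      map_smul, h1]
    simp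
  have h4 : ‖ψ (algebraMap ℝ U ‖star b * b‖ - star b * b)‖ ≤ ‖star b * b‖ :=
    ((ψ.le_opNorm _).trans (mul_le_of_le_one_left (norm_nonneg _) hψ)).trans h2
  rw [h3] at h4
  have h5 := (Complex.re_le_norm _).trans h4
  rw [Complex.sub_re, Complex.ofReal_re] at h5
  linarith

/-- The norm is attained in the spectrum, hence by a character of the C⋆-algebra generated by `b`.
Its Hahn-Banach extension is contractive and unital, therefore positive. -/
theorem exists_state_norm_eq [Nontrivial U] {b : U} (hb : IsSelfAdjoint b) :
    ∃ ψ : StrongDual ℂ U, (∀ c, 0 ≤ ψ (star c * c)) ∧ ψ 1 = 1 ∧ ‖ψ b‖ = ‖b‖ := by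
  have : IsStarNormal b := hb.isStarNormal
  obtain ⟨z, hz, hzb⟩ := spectrum.exists_nnnorm_eq_spectralRadius b
  rw [hb.spectralRadius_eq_nnnorm] at hzb
  have hzb : ‖z‖ = ‖b‖ := congrArg NNReal.toReal (ENNReal.coe_inj.1 hzb)
  let E := StarAlgebra.elemental ℂ b
  let b' : E := ⟨b, StarAlgebra.elemental.self_mem ℂ b⟩
  have hz' : z ∈ spectrum ℂ b' := by
    rw [StarSubalgebra.spectrum_eq (hS := StarAlgebra.elemental.isClosed ℂ b)]
    exact hz
  obtain ⟨x, hx⟩ := WeakDual.CharacterSpace.mem_spectrum_iff_exists.1 hz'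
  let f : StrongDual ℂ (Subalgebra.toSubmodule E.toSubalgebra) := (x : WeakDual ℂ E).toStrongDual
  obtain ⟨g, hg, hgn⟩ := exists_extension_norm_eq (Subalgebra.toSubmodule E.toSubalgebra) f
  have hf : ‖g‖ ≤ 1 := by
    rw [hgn]
    refine f.opNorm_le_bound zero_le_one fun c => ?_
    rw [one_mul]
    exact norm_character_le x c
  have hg1 : g 1 = 1 := (hg (1 : E)).trans (map_one x)
  refine ⟨g, nonneg_of_norm_le_one hf hg1, hg1, ?_⟩
  rw [← hzb, ← hx]
  exact congrArg norm (hg b')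

end HahnBanach

/-! ### The smallest unitization and its positive functionals -/

section MinUnitization

variable {A : Type*} [NonUnitalCStarAlgebra A]

/-- A complete subspace plus a finite-dimensional one is closed. As a local instance this makes `uA`
a C⋆-algebra. -/
theorem isClosed_minUnitization :
    IsClosed (MinUnitization A : Set (DoubleCentralizer ℂ A)) := by
  let f : A →ₗ[ℂ] DoubleCentralizer ℂ A :=
    { toFun := DoubleCentralizer.coeHom (𝕜 := ℂ)
      map_add' := map_add _
      map_smul' := map_smul (DoubleCentralizer.coeHom (𝕜 := ℂ)) }
  have hf : IsClosed (LinearMap.range f : Set (DoubleCentralizer ℂ A)) := by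
    have hi : Isometry f := AddMonoidHomClass.isometry_of_norm f fun a => (incl A).norm_map a
    rw [LinearMap.coe_range]
    exact hi.isClosedEmbedding.isClosed_range
  have h := Submodule.isClosed_sup_finiteDimensional (LinearMap.range f)
    (Submodule.span ℂ {(1 : DoubleCentralizer ℂ A)}) hf
  convert h using 1
  ext x
  rw [SetLike.mem_coe, SetLike.mem_coe, Submodule.mem_sup]
  constructor
  · rintro ⟨a, c, rfl⟩
    exact ⟨f a, ⟨a, rfl⟩, algebraMap ℂ _ c,
      Submodule.mem_span_singleton.2 ⟨c, (Algebra.algebraMap_eq_smul_one c).symm⟩, rfl⟩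
  · rintro ⟨_, ⟨a, rfl⟩, z, hz, rfl⟩
    obtain ⟨c, rfl⟩ := Submodule.mem_span_singleton.1 hz
    exact ⟨a, c, by rw [Algebra.algebraMap_eq_smul_one]; rfl⟩

attribute [local instance] isClosed_minUnitization

theorem incl_mul (a b : A) : incl A (a * b) = incl A a * incl A b :=
  Subtype.ext (map_mul (DoubleCentralizer.coeHom (𝕜 := ℂ)) a b)

theorem incl_star (a : A) : incl A (star a) = star (incl A a) :=
  Subtype.ext (map_star (DoubleCentralizer.coeHom (𝕜 := ℂ)) a)

theorem exists_eq_incl_add (b : MinUnitization A) :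
    ∃ (a : A) (c : ℂ), b = incl A a + c • 1 := by
  obtain ⟨b, a, c, rfl⟩ := b
  exact ⟨a, c, Subtype.ext (congrArg (DoubleCentralizer.coeHom (𝕜 := ℂ) a + ·)
    (Algebra.algebraMap_eq_smul_one c))⟩

theorem exists_eq_incl_add_real {b : MinUnitization A} (hb : IsSelfAdjoint b) :
    ∃ (a : A) (r : ℝ), b = incl A a + (r : ℂ) • 1 := by
  obtain ⟨a, c, rfl⟩ := exists_eq_incl_add b
  refine ⟨(1 / 2 : ℂ) • (a + star a), c.re, ?_⟩
  have h1 : star (incl A a) + (starRingEnd ℂ c) • 1 = incl A a + c • 1 := by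
    have := hb.star_eq
    rwa [star_add, star_smul, star_one] at this
  have h2 : (c.re : ℂ) = (1 / 2) * (c + starRingEnd ℂ c) := by
    rw [Complex.add_conj]; push_cast; ring
  rw [map_smul, map_add, incl_star, h2, mul_smul, add_smul]
  have h3 : incl A a + c • (1 : MinUnitization A) =
      (1 / 2 : ℂ) • ((incl A a + c • 1) + (star (incl A a) + (starRingEnd ℂ c) • 1)) := by
    rw [h1]; module
  rw [h3]; module

/-- `A` is an ideal of `uA`, so compressions can be tested by the topology `σ(A*, A)`. -/
theorem exists_incl_mul_mul (f g : A) (b : MinUnitization A) :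
    ∃ c : A, incl A f * b * incl A g = incl A c := by
  obtain ⟨a, c, rfl⟩ := exists_eq_incl_add b
  exact ⟨f * a * g + c • (f * g), by
    simp only [mul_add, add_mul, mul_smul_comm, smul_mul_assoc, mul_one, map_add, map_smul,
      incl_mul]⟩

instance [Nontrivial A] : Nontrivial (MinUnitization A) :=
  (incl A).injective.nontrivial

section

variable {φ : StrongDual ℂ (MinUnitization A)}

theorem norm_apply_mul_sq_le (hφ : ∀ b, 0 ≤ φ (star b * b)) (x y : MinUnitization A) :
    ‖φ (star x * y)‖ ^ 2 ≤ (φ (star x * x)).re * (φ (star y * y)).re :=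
  IsPositiveFunctional.norm_sq_le (φ := φ.toLinearMap) hφ x y

theorem apply_star (hφ : ∀ b, 0 ≤ φ (star b * b)) (x : MinUnitization A) :
    φ (star x) = starRingEnd ℂ (φ x) := by
  have := IsPositiveFunctional.conj_apply (φ := φ.toLinearMap) hφ x 1
  simpa using this.symm

theorem apply_star_mul_self_le (hφ : ∀ b, 0 ≤ φ (star b * b)) (h1 : φ 1 = 1)
    (x : MinUnitization A) : (φ (star x * x)).re ≤ ‖x‖ ^ 2 := by
  let _ := CStarAlgebra.spectralOrder (MinUnitization A)
  have _ := CStarAlgebra.spectralOrderedRing (MinUnitization A)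
  have h2 : 0 ≤ algebraMap ℝ (MinUnitization A) ‖star x * x‖ - star x * x :=
    sub_nonneg.2 (IsSelfAdjoint.star_mul_self x).le_algebraMap_norm_self
  obtain ⟨c, hc⟩ := CStarAlgebra.nonneg_iff_eq_star_mul_self.1 h2
  have h3 := hφ c
  rw [← hc, map_sub, IsScalarTower.algebraMap_apply ℝ ℂ (MinUnitization A),
    Algebra.algebraMap_eq_smul_one (A := MinUnitization A), map_smul, h1,
    CStarRing.norm_star_mul_self] at h3
  have h4 := (Complex.nonneg_iff.1 h3).1
  simp only [Complex.sub_re, smul_eq_mul, mul_one, Complex.coe_algebraMap, Complex.ofReal_re] at h4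
  rw [sq]; linarith

theorem norm_apply_le (hφ : ∀ b, 0 ≤ φ (star b * b)) (h1 : φ 1 = 1)
    (x : MinUnitization A) : ‖φ x‖ ≤ ‖x‖ := by
  have h := norm_apply_mul_sq_le hφ 1 x
  simp only [star_one, one_mul, h1, Complex.one_re] at h
  exact le_of_sq_le_sq (h.trans (apply_star_mul_self_le hφ h1 x)) (norm_nonneg _)

variable [PartialOrder A] [StarOrderedRing A]

theorem apply_incl_nonneg (hφ : ∀ b, 0 ≤ φ (star b * b)) {a : A} (ha : 0 ≤ a) :
    0 ≤ φ (incl A a) := by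
  obtain ⟨c, rfl⟩ := CStarAlgebra.nonneg_iff_eq_star_mul_self.1 ha
  rw [incl_mul, incl_star]
  exact hφ _

theorem apply_incl_mono (hφ : ∀ b, 0 ≤ φ (star b * b)) {a b : A} (hab : a ≤ b) :
    (φ (incl A a)).re ≤ (φ (incl A b)).re := by
  have h := (Complex.nonneg_iff.1 (apply_incl_nonneg hφ (sub_nonneg.2 hab))).1
  rw [map_sub, map_sub, Complex.sub_re] at h
  linarith

end

end MinUnitization

end

noncomputable section

/-! ### Ramp functions -/

section Ramp

/-- The continuous piecewise linear function which is `0` below `s` and `1` above `t`. -/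
def ramp (s t : ℝ) (r : ℝ) : ℝ := max 0 (min 1 ((r - s) / (t - s)))

variable {s t : ℝ}

theorem continuous_ramp : Continuous (ramp s t) := by
  unfold ramp
  fun_prop

theorem ramp_nonneg (r : ℝ) : 0 ≤ ramp s t r := le_max_left _ _

theorem ramp_le_one (r : ℝ) : ramp s t r ≤ 1 := max_le zero_le_one (min_le_left _ _)

theorem ramp_of_le (hst : s < t) {r : ℝ} (hr : r ≤ s) : ramp s t r = 0 :=
  max_eq_left ((min_le_right _ _).trans
    (div_nonpos_of_nonpos_of_nonneg (by linarith) (by linarith)))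

theorem ramp_of_ge (hst : s < t) {r : ℝ} (hr : t ≤ r) : ramp s t r = 1 := by
  rw [ramp, min_eq_left ((one_le_div (by linarith)).2 (by linarith)), max_eq_right zero_le_one]

end Ramp

/-! ### Compact level sets and cutoffs inside the topography -/

namespace Topography

variable {A : Type*} [NonUnitalCStarAlgebra A] (M : Topography A)

theorem isClosed_alg : IsClosed (M.alg : Set A) := M.isClosed

attribute [local instance] isClosed_alg isClosed_minUnitization

variable {M}

theorem eq_of_character_eq {a b : M.alg} (h : ∀ x : M.spec, x a = x b) : a = b := by
  refine sub_eq_zero.1 (eq_zero_of_character_eq_zero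
    (fun a b => Subtype.ext (M.mul_comm _ a.2 _ b.2)) fun x => ?_)
  have : x (a - b) = x a - x b := map_sub x a b
  rw [this, h, sub_self]

theorem character_mul (x : M.spec) (a b : M.alg) : x (a * b) = x a * x b := x.2.2 a b

theorem re_character_star_mul_self_nonneg (x : M.spec) (a : M.alg) : 0 ≤ (x (star a * a)).re := by
  rw [character_star_mul_self, Complex.ofReal_re]
  positivity

theorem coe_cfcₙ {h : M.alg} (hh : IsSelfAdjoint h) {F : ℝ → ℝ} (hF : Continuous F)
    (hF0 : F 0 = 0) : ((cfcₙ F h : M.alg) : A) = cfcₙ F (h : A) :=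
  NonUnitalStarAlgHom.map_cfcₙ (R := ℝ) (S := ℂ) (NonUnitalStarSubalgebraClass.subtype M.alg) F h
    hF.continuousOn hF0 continuous_subtype_val hh
    (hh.map (NonUnitalStarSubalgebraClass.subtype M.alg))

/-- The compact set of characters at which a given element has real part at least `t > 0`. -/
def level (h : M.alg) {t : ℝ} (ht : 0 < t) : TopologicalSpace.Compacts M.spec where
  carrier := {x | t ≤ (x h).re}
  isCompact' := by
    have hc : IsCompact ((WeakDual.toStrongDual ⁻¹' Metric.closedBall (0 : StrongDual ℂ M.alg) 1) ∩
        ({x : WeakDual ℂ M.alg | t ≤ (x h).re} ∩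
        {x : WeakDual ℂ M.alg | ∀ a b, x (a * b) = x a * x b})) := by
      refine (WeakDual.isCompact_closedBall 0 1).inter_right (IsClosed.inter ?_ ?_)
      · exact isClosed_le continuous_const (Complex.continuous_re.comp (WeakDual.eval_continuous h))
      · simp only [Set.ofPred_forall]
        exact isClosed_iInter fun a => isClosed_iInter fun b => isClosed_eq
          (WeakDual.eval_continuous _)
          ((WeakDual.eval_continuous _).mul (WeakDual.eval_continuous _))
    rw [Topology.IsInducing.subtypeVal.isCompact_iff]
    convert hc using 1
    ext x
    constructor
    · rintro ⟨y, hy, rfl⟩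
      refine ⟨?_, hy, y.2.2⟩
      rw [Set.mem_preimage, mem_closedBall_zero_iff]
      refine ContinuousLinearMap.opNorm_le_bound _ zero_le_one fun a => ?_
      rw [one_mul]
      exact norm_character_le y a
    · rintro ⟨-, hx, hm⟩
      refine ⟨⟨x, ?_, hm⟩, hx, rfl⟩
      -- Positivity of `t` excludes the zero functional, the only possible limit of characters that
      -- is not a character.
      rintro rfl
      exact absurd hx (not_le.2 (by simpa using ht))

theorem level_mono {h : M.alg} {s t : ℝ} (hs : 0 < s) (hst : s ≤ t) :
    level h (hs.trans_le hst) ≤ level h hs := fun _ hx => hst.trans hx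

/-- An element of the topography which is a ramp function of a given one. -/
abbrev rampOf (h : M.alg) (s t : ℝ) : M.alg := cfcₙ (ramp s t) h

theorem norm_rampOf_le {h : M.alg} {s t : ℝ} : ‖rampOf h s t‖ ≤ 1 :=
  norm_cfcₙ_le fun r _ => by
    rw [Real.norm_of_nonneg (ramp_nonneg r)]
    exact ramp_le_one r

theorem character_rampOf {h : M.alg} {s t : ℝ} (hh : IsSelfAdjoint h) (hs : 0 ≤ s) (hst : s < t)
    (x : M.spec) : x (rampOf h s t) = ramp s t (x h).re :=
  character_cfcₙ x hh continuous_ramp (ramp_of_le hst hs)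

/-- `f` is supported in `K`. -/
def SupportedIn (f : M.alg) (K : TopologicalSpace.Compacts M.spec) : Prop :=
  ∀ x : M.spec, x ∉ K → x f = 0

theorem rampOf_supportedIn {h : M.alg} (hh : IsSelfAdjoint h) {s t : ℝ} (hs : 0 < s) (hst : s < t) :
    SupportedIn (rampOf h s t) (level h hs) := fun x hx => by
  rw [character_rampOf hh hs.le hst, ramp_of_le hst (not_le.1 hx).le, Complex.ofReal_zero]

variable [PartialOrder A]

theorem Majorant.mul_eq {K : TopologicalSpace.Compacts M.spec} (g : M.Majorant K) {f : M.alg}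
    (hf : SupportedIn f K) : g.1 * f = f := by
  refine eq_of_character_eq fun x => ?_
  rw [character_mul]
  by_cases hx : x ∈ K
  · rw [g.2.2.2 x hx, one_mul]
  · rw [hf x hx, mul_zero]

variable [StarOrderedRing A]

/-- Positivity in `A` descends to `M`, because the square root is computed by functional calculus
inside `M`. -/
theorem exists_eq_star_mul_self {a : M.alg} (ha : 0 ≤ (a : A)) : ∃ k : M.alg, a = star k * k := by
  have hs : IsSelfAdjoint a := Subtype.ext (IsSelfAdjoint.of_nonneg ha).star_eq
  refine ⟨cfcₙ Real.sqrt a, ?_⟩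
  rw [(IsSelfAdjoint.cfcₙ (f := Real.sqrt) (a := a)).star_eq]
  refine Subtype.ext ?_
  change (a : A) = ((cfcₙ Real.sqrt a : M.alg) : A) * ((cfcₙ Real.sqrt a : M.alg) : A)
  rw [coe_cfcₙ hs Real.continuous_sqrt Real.sqrt_zero, ← cfcₙ_mul Real.sqrt Real.sqrt (a : A)]
  conv_lhs => rw [← cfcₙ_id ℝ (a : A)]
  refine cfcₙ_congr fun r hr => ?_
  exact (Real.mul_self_sqrt (quasispectrum_nonneg_of_nonneg _ ha r hr)).symm

theorem coe_star_mul_self_nonneg (k : M.alg) : 0 ≤ ((star k * k : M.alg) : A) :=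
  star_mul_self_nonneg (k : A)

theorem re_character_nonneg (x : M.spec) {a : M.alg} (ha : 0 ≤ (a : A)) : 0 ≤ (x a).re := by
  obtain ⟨k, rfl⟩ := exists_eq_star_mul_self ha
  exact re_character_star_mul_self_nonneg x k

theorem ofReal_re_character (x : M.spec) {a : M.alg} (ha : 0 ≤ (a : A)) : ((x a).re : ℂ) = x a := by
  obtain ⟨k, rfl⟩ := exists_eq_star_mul_self ha
  rw [character_star_mul_self, Complex.ofReal_re]

theorem re_character_mono (x : M.spec) {a b : M.alg} (hab : (a : A) ≤ b) : (x a).re ≤ (x b).re := by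
  have h := re_character_nonneg x (a := b - a) (sub_nonneg.2 hab)
  have : x (b - a) = x b - x a := map_sub x b a
  rw [this, Complex.sub_re] at h
  linarith

theorem coe_cfcₙ_nonneg (h : M.alg) {F : ℝ → ℝ} (hF : Continuous F) (hF0 : F 0 = 0)
    (hn : ∀ r, 0 ≤ F r) : 0 ≤ ((cfcₙ F h : M.alg) : A) := by
  have e : (cfcₙ F h : M.alg) =
      star (cfcₙ (fun r => Real.sqrt (F r)) h) * cfcₙ (fun r => Real.sqrt (F r)) h := by
    rw [(IsSelfAdjoint.cfcₙ (f := fun r => Real.sqrt (F r)) (a := h)).star_eq,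
      ← cfcₙ_mul (fun r => Real.sqrt (F r)) (fun r => Real.sqrt (F r)) h
        (by fun_prop) (by simp [hF0]) (by fun_prop) (by simp [hF0])]
    exact cfcₙ_congr fun r _ => (Real.mul_self_sqrt (hn r)).symm
  rw [e]
  exact coe_star_mul_self_nonneg _

section rampOf

variable {h : M.alg} {s t : ℝ}

theorem rampOf_nonneg (hs : 0 ≤ s) (hst : s < t) : 0 ≤ (rampOf h s t : A) :=
  coe_cfcₙ_nonneg h continuous_ramp (ramp_of_le hst hs) ramp_nonneg

/-- A ramp function of a self-adjoint element, as a majorant. -/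
def rampMajorant (hh : IsSelfAdjoint h) (hs : 0 ≤ s) (hst : s < t)
    {K : TopologicalSpace.Compacts M.spec} (hK : ∀ x ∈ K, t ≤ (x h).re) : M.Majorant K :=
  ⟨rampOf h s t, rampOf_nonneg hs hst, norm_rampOf_le, fun x hx => by
    rw [character_rampOf hh hs hst, ramp_of_ge hst (hK x hx), Complex.ofReal_one]⟩

end rampOf

end Topography
end

noncomputable section

attribute [local instance] isClosed_minUnitization Topography.isClosed_alg

/-! ### Local states, corners and compressions -/

section Contraction

variable {A : Type*} [NonUnitalCStarAlgebra A] {φ : StrongDual ℂ (MinUnitization A)}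

/-- Here `φ((1 - g)²) = φ(g²) - 1 ≤ 0`, so Cauchy-Schwarz kills `φ((1 - g) b)`. -/
theorem apply_mul_eq_of_apply_eq_one (hφ : ∀ b, 0 ≤ φ (star b * b)) (h1 : φ 1 = 1) {g : A}
    (hg : IsSelfAdjoint g) (hg1 : ‖g‖ ≤ 1) (hgφ : φ (incl A g) = 1) (b : MinUnitization A) :
    φ (incl A g * b) = φ b := by
  have hs : star (1 - incl A g) = 1 - incl A g := by
    rw [star_sub, star_one, ← incl_star, hg.star_eq]
  have h2 : (φ (star (1 - incl A g) * (1 - incl A g))).re ≤ 0 := by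
    have h3 : ‖φ (incl A g * incl A g)‖ ≤ 1 := by
      refine (norm_apply_le hφ h1 _).trans ((norm_mul_le _ _).trans ?_)
      rw [(incl A).norm_map]
      exact mul_le_one₀ hg1 (norm_nonneg _) hg1
    have h4 := (Complex.re_le_norm _).trans h3
    rw [hs]
    simp only [sub_mul, mul_sub, one_mul, mul_one, map_sub, h1, hgφ, Complex.sub_re, Complex.one_re]
    linarith
  have h5 := norm_apply_mul_sq_le hφ (1 - incl A g) b
  rw [hs] at h5 h2
  have h6 : 0 ≤ (φ (star b * b)).re := (Complex.nonneg_iff.1 (hφ b)).1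
  have h7 : ‖φ ((1 - incl A g) * b)‖ ^ 2 ≤ 0 := h5.trans (mul_nonpos_of_nonpos_of_nonneg h2 h6)
  have h8 : φ ((1 - incl A g) * b) = 0 := by
    rw [← norm_eq_zero]
    exact pow_eq_zero_iff two_ne_zero |>.1 (le_antisymm h7 (by positivity))
  rw [sub_mul, one_mul, map_sub] at h8
  exact (sub_eq_zero.1 h8).symm

theorem apply_mul_eq_of_apply_eq_one' (hφ : ∀ b, 0 ≤ φ (star b * b)) (h1 : φ 1 = 1) {g : A}
    (hg : IsSelfAdjoint g) (hg1 : ‖g‖ ≤ 1) (hgφ : φ (incl A g) = 1) (b : MinUnitization A) :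
    φ (b * incl A g) = φ b := by
  have h := apply_mul_eq_of_apply_eq_one hφ h1 hg hg1 hgφ (star b)
  have h2 : star (incl A g * star b) = b * incl A g := by
    rw [star_mul, star_star, ← incl_star, hg.star_eq]
  rw [← h2, apply_star hφ, h, apply_star hφ, Complex.conj_conj]

/-- A positive unital functional which is `1` at some element of the unit ball of `A` is a state. -/
def State.ofApplyEqOne (hφ : ∀ b, 0 ≤ φ (star b * b)) (h1 : φ 1 = 1)
    (hg : ∃ g : A, ‖g‖ ≤ 1 ∧ φ (incl A g) = 1) : State A :=
  ⟨φ, hφ, h1, by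
    obtain ⟨g, hg1, hg⟩ := hg
    refine le_antisymm (ContinuousLinearMap.opNorm_le_bound _ zero_le_one fun a => ?_) ?_
    · rw [one_mul, ← (incl A).norm_map a]
      exact norm_apply_le hφ h1 _
    · have h := (φ.comp (incl A).toContinuousLinearMap).le_opNorm g
      have h2 : ‖(φ.comp (incl A).toContinuousLinearMap) g‖ = 1 := by
        change ‖φ (incl A g)‖ = 1
        rw [hg, norm_one]
      rw [h2] at h
      exact h.trans (mul_le_of_le_one_right (norm_nonneg _) hg1)⟩

end Contraction

namespace Topography

theorem exists_ne_zero {A : Type*} [NonUnitalCStarAlgebra A] [Nontrivial A] (M : Topography A) :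
    ∃ m : M.alg, m ≠ 0 := by
  by_contra! h
  obtain ⟨l, hl, hM⟩ := M.exists_approximateUnit
  obtain ⟨a, ha⟩ := exists_ne (0 : A)
  have := hl.neBot
  refine ha (tendsto_nhds_unique (hl.tendsto_mul_left a) (tendsto_const_nhds.congr' ?_))
  filter_upwards [hM] with m hm
  have : m = 0 := congrArg Subtype.val (h ⟨m, hm⟩)
  rw [this, mul_zero]

variable {A : Type*} [NonUnitalCStarAlgebra A] {M : Topography A} [PartialOrder A]
  [StarOrderedRing A] {K : TopologicalSpace.Compacts M.spec}

theorem Majorant.isSelfAdjoint (g : M.Majorant K) : IsSelfAdjoint (g.1 : A) :=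
  .of_nonneg g.2.1

/-- The net of majorants decreases to a value `1`, and each term is at most `1`. Nonemptiness
matters: over an empty index set the limit defining `indicator` carries no information. -/
theorem apply_majorant_eq_one [Nonempty (M.Majorant K)] {φ : State A} (hφ : φ ∈ M.statesOn K)
    (g : M.Majorant K) : φ.1 (incl A g.1) = 1 := by
  have h1 : M.indicator K φ.1 = 1 := hφ
  have h2 := M.tendsto_indicator K φ.1
  rw [h1] at h2
  have h3 := apply_incl_nonneg φ.2.1 g.2.1
  have h4 : 1 ≤ (φ.1 (incl A g.1)).re := by
    refine le_of_tendsto ((Complex.continuous_re.tendsto 1).comp h2) ?_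
    filter_upwards [Ici_mem_atTop g] with k hk
    exact apply_incl_mono φ.2.1 hk
  have h5 : (φ.1 (incl A g.1)).re ≤ 1 := by
    refine (Complex.re_le_norm _).trans ((norm_apply_le φ.2.1 φ.2.2.1 _).trans ?_)
    rw [(incl A).norm_map]
    exact g.2.2.1
  exact Complex.ext (le_antisymm h5 h4) (Complex.nonneg_iff.1 h3).2.symm

theorem mem_statesOn_iff [Nonempty (M.Majorant K)] {φ : State A} :
    φ ∈ M.statesOn K ↔ ∀ g : M.Majorant K, φ.1 (incl A g.1) = 1 := by
  refine ⟨apply_majorant_eq_one, fun h => ?_⟩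
  refine tendsto_nhds_unique (M.tendsto_indicator K φ.1) ?_
  simp only [h]
  exact tendsto_const_nhds

theorem apply_majorant_mul_mul [Nonempty (M.Majorant K)] {φ : State A} (hφ : φ ∈ M.statesOn K)
    (f g : M.Majorant K) (b : MinUnitization A) :
    φ.1 (incl A f.1 * b * incl A g.1) = φ.1 b := by
  rw [apply_mul_eq_of_apply_eq_one' φ.2.1 φ.2.2.1 g.isSelfAdjoint g.2.2.1
    (apply_majorant_eq_one hφ g), apply_mul_eq_of_apply_eq_one φ.2.1 φ.2.2.1 f.isSelfAdjoint
    f.2.2.1 (apply_majorant_eq_one hφ f)]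

/-- The first Arens product makes the corner the iterated limit of `φ(f a g)`, first in `g`, then in
`f`. Eventual bounds thus pass to it. -/
theorem norm_corner_sub_le [Nonempty (M.Majorant K)] (φ : State A) (a : MinUnitization A) (c : ℂ)
    {δ : ℝ} (f₀ : M.Majorant K)
    (h : ∀ f g : M.Majorant K, f₀ ≤ f → f₀ ≤ g → ‖φ.1 (incl A f.1 * a * incl A g.1) - c‖ ≤ δ) :
    ‖M.corner K a φ.1 - c‖ ≤ δ := by
  let R (z : MinUnitization A) : StrongDual ℂ (MinUnitization A) :=
    φ.1.comp (ContinuousLinearMap.mul ℂ (MinUnitization A) z)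
  have h1 : ∀ f : M.Majorant K, f₀ ≤ f →
      ‖M.indicator K (R (incl A f.1 * a)) - c‖ ≤ δ := by
    intro f hf
    refine le_of_tendsto ((M.tendsto_indicator K (R (incl A f.1 * a))).sub_const c).norm ?_
    filter_upwards [Ici_mem_atTop f₀] with g hg
    exact h f g hf hg
  have h2 := M.tendsto_indicator K
    ((arensMul (NormedSpace.inclusionInDoubleDual ℂ (MinUnitization A) a) (M.indicator K)).comp
      ((ContinuousLinearMap.compL ℂ (MinUnitization A) (MinUnitization A) ℂ φ.1).comp
      (ContinuousLinearMap.mul ℂ (MinUnitization A))))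
  refine le_of_tendsto (h2.sub_const c).norm ?_
  filter_upwards [Ici_mem_atTop f₀] with f hf
  refine le_trans (le_of_eq ?_) (h1 f hf)
  have h3 : R (incl A f.1 * a) = (R (incl A f.1)).comp (ContinuousLinearMap.mul ℂ _ a) := by
    ext z
    exact congrArg φ.1 (mul_assoc _ _ _)
  rw [h3]
  rfl

theorem corner_apply_of_mem [Nonempty (M.Majorant K)] {φ : State A} (hφ : φ ∈ M.statesOn K)
    (a : MinUnitization A) : M.corner K a φ.1 = φ.1 a := by
  obtain ⟨f₀⟩ := ‹Nonempty (M.Majorant K)›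
  have : Nonempty (M.Majorant K) := ⟨f₀⟩
  have h := norm_corner_sub_le φ a (φ.1 a) f₀ (δ := 0) fun f g _ _ => by
    rw [apply_majorant_mul_mul hφ, sub_self, norm_zero]
  exact sub_eq_zero.1 (norm_le_zero_iff.1 h)

theorem statesOn_mono {K' : TopologicalSpace.Compacts M.spec} (hK : K ≤ K')
    [Nonempty (M.Majorant K)] [Nonempty (M.Majorant K')] : M.statesOn K ⊆ M.statesOn K' :=
  fun _ hφ => mem_statesOn_iff.2 fun g => apply_majorant_eq_one hφ
    (⟨g.1, g.2.1, g.2.2.1, fun x hx => g.2.2.2 x (hK hx)⟩ : M.Majorant K)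

/-- The state is `ψ(f · f) / ψ(f²)`. It lies in `𝒮(A|K)` because `g f = f` for every majorant `g` of
`1_K`. -/
theorem exists_state_compress [Nonempty (M.Majorant K)] {ψ : StrongDual ℂ (MinUnitization A)}
    (hψ : ∀ b, 0 ≤ ψ (star b * b)) {f : M.alg} (hf : IsSelfAdjoint f) (hfK : SupportedIn f K)
    (h0 : ψ (incl A f * incl A f) ≠ 0) :
    ∃ φ ∈ M.statesOn K, ∀ a, φ.1 a * ψ (incl A f * incl A f) = ψ (incl A f * a * incl A f) := by
  have hs : star (incl A (f : A)) = incl A f := by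
    rw [← incl_star]
    exact congrArg (fun m : M.alg => incl A (m : A)) hf.star_eq
  have hpos : 0 ≤ ψ (incl A f * incl A f) := by
    have := hψ (incl A f)
    rwa [hs] at this
  let χ : StrongDual ℂ (MinUnitization A) := (ψ (incl A f * incl A f))⁻¹ •
    ψ.comp (ContinuousLinearMap.mulLeftRight ℂ (MinUnitization A) (incl A f) (incl A f))
  have hχ : ∀ a, χ a = (ψ (incl A f * incl A f))⁻¹ * ψ (incl A f * a * incl A f) := fun a => rfl
  have hg : ∀ g : M.Majorant K, χ (incl A g.1) = 1 := fun g => by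
    have h2 : incl A (g.1 : A) * incl A f = incl A f := by
      rw [← incl_mul]
      exact congrArg (fun m : M.alg => incl A (m : A)) (g.mul_eq hfK)
    rw [hχ, mul_assoc, h2, inv_mul_cancel₀ h0]
  have hχp : ∀ b, 0 ≤ χ (star b * b) := fun b => by
    rw [hχ]
    refine mul_nonneg (inv_nonneg.2 hpos) ?_
    have := hψ (b * incl A f)
    rwa [star_mul, hs, mul_assoc, ← mul_assoc (star b), ← mul_assoc] at this
  have hχ1 : χ 1 = 1 := by rw [hχ, mul_one, inv_mul_cancel₀ h0]
  obtain ⟨g⟩ := ‹Nonempty (M.Majorant K)›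
  have : Nonempty (M.Majorant K) := ⟨g⟩
  refine ⟨State.ofApplyEqOne hχp hχ1 ⟨g.1, g.2.2.1, hg g⟩, mem_statesOn_iff.2 hg, fun a => ?_⟩
  change χ a * _ = _
  rw [hχ]
  field_simp

/-- Compress a state norming `f a f`; if it vanishes at `f²`, Cauchy-Schwarz makes it vanish at `f a
f` too. -/
theorem norm_mul_mul_le [Nontrivial A] [Nonempty (M.Majorant K)] {f : M.alg}
    (hf : IsSelfAdjoint f) (hfK : SupportedIn f K) {a : MinUnitization A} (ha : IsSelfAdjoint a)
    {c : ℝ} (hc : 0 ≤ c) (h : ∀ φ ∈ M.statesOn K, ‖φ.1 a‖ ≤ c) :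
    ‖incl A f * a * incl A f‖ ≤ c * ‖f‖ ^ 2 := by
  have hs : star (incl A (f : A)) = incl A f := by
    rw [← incl_star]
    exact congrArg (fun m : M.alg => incl A (m : A)) hf.star_eq
  have hb : IsSelfAdjoint (incl A f * a * incl A f) := by
    have := ha.conjugate (incl A f)
    rwa [hs] at this
  obtain ⟨ψ, hψ, h1, hn⟩ := exists_state_norm_eq hb
  rw [← hn]
  by_cases h0 : ψ (incl A f * incl A f) = 0
  · have h2 := norm_apply_mul_sq_le hψ (incl A f) (a * incl A f)
    rw [hs, h0, Complex.zero_re, zero_mul, ← mul_assoc] at h2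
    have h3 : ‖ψ (incl A f * a * incl A f)‖ = 0 :=
      pow_eq_zero_iff two_ne_zero |>.1 (le_antisymm h2 (by positivity))
    rw [h3]
    positivity
  · obtain ⟨φ, hφ, hφψ⟩ := exists_state_compress hψ hf hfK h0
    rw [← hφψ, norm_mul]
    refine mul_le_mul (h φ hφ) ?_ (norm_nonneg _) hc
    refine (norm_apply_le hψ h1 _).trans ((norm_mul_le _ _).trans ?_)
    rw [(incl A).norm_map, sq]
    rfl

theorem exists_mem_localStates [Nontrivial A] (M : Topography A) : ∃ φ, φ ∈ M.localStates := by
  obtain ⟨m, hm⟩ := M.exists_ne_zero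
  obtain ⟨x, hx⟩ : ∃ x : M.spec, x m ≠ 0 := by
    by_contra! h
    exact hm (eq_of_character_eq fun x => (h x).trans (map_zero x).symm)
  have ht : 0 < (x (star m * m)).re := by
    rw [character_star_mul_self, Complex.ofReal_re]
    positivity
  set t := (x (star m * m)).re with htdef
  have hb : IsSelfAdjoint (star m * m) := .star_mul_self m
  have : Nonempty (M.Majorant (level (star m * m) (half_pos ht))) :=
    ⟨rampMajorant hb (s := t / 4) (by positivity) (by linarith) fun y hy => hy⟩
  have hf := rampOf_supportedIn hb (half_pos ht) (half_lt_self ht)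
  have hs : IsSelfAdjoint (rampOf (star m * m) (t / 2) t) := IsSelfAdjoint.cfcₙ
  have h1 : x (rampOf (star m * m) (t / 2) t) = 1 := by
    rw [character_rampOf hb (half_pos ht).le (half_lt_self ht), ramp_of_ge (half_lt_self ht) le_rfl,
      Complex.ofReal_one]
  by_contra! h
  -- Without local states the estimate holds vacuously with `c = 0`, forcing `f² = 0` for a ramp `f`
  -- which is `1` at `x`.
  have h2 := norm_mul_mul_le hs hf (a := 1) (.one _) le_rfl fun φ hφ =>
    (h φ (Set.mem_iUnion.2 ⟨_, hφ⟩)).elim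
  rw [zero_mul, norm_le_zero_iff, mul_one, ← incl_mul, map_eq_zero_iff _ (incl A).injective] at h2
  have h3 : rampOf (star m * m) (t / 2) t * rampOf (star m * m) (t / 2) t = 0 := Subtype.ext h2
  have h4 := congrArg x h3
  rw [character_mul, h1, map_zero, one_mul] at h4
  exact one_ne_zero h4

end Topography
end

noncomputable section

attribute [local instance] isClosed_minUnitization Topography.isClosed_alg

/-! ### The Monge-Kantorovich metric -/

section Seminorm

variable {A : Type*} [NonUnitalCStarAlgebra A]

theorem State.apply_smul_one (φ : State A) (c : ℂ) : φ.1 (c • 1) = c := by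
  rw [map_smul, φ.2.2.1, smul_eq_mul, mul_one]

namespace LipschitzSeminorm

variable {L : LipschitzSeminorm A} {b : MinUnitization A}

theorem isSelfAdjoint_of_mem_unitBall (hb : b ∈ L.unitBall) : IsSelfAdjoint b := by
  obtain ⟨a, -, -, rfl⟩ := hb
  exact a.2

theorem add_smul_one_mem_unitBall (hb : b ∈ L.unitBall) (r : ℝ) :
    b + (r : ℂ) • 1 ∈ L.unitBall := by
  obtain ⟨a, ha, ha1, rfl⟩ := hb
  obtain ⟨h1, h2⟩ := (L.seminorm_eq_zero_iff (r • 1)).2 ⟨r, rfl⟩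
  refine ⟨a + r • 1, L.domain.add_mem ha h1, ?_, ?_⟩
  · calc L.seminorm ⟨a + r • 1, L.domain.add_mem ha h1⟩
        = L.seminorm (⟨a, ha⟩ + ⟨r • 1, h1⟩) := rfl
      _ ≤ L.seminorm ⟨a, ha⟩ + L.seminorm ⟨r • 1, h1⟩ := map_add_le_add _ _ _
      _ ≤ 1 := by rw [h2, add_zero]; exact ha1
  · rw [Complex.coe_smul]
    rfl

theorem ofReal_re_apply (hb : IsSelfAdjoint b) (μ : State A) : ((μ.1 b).re : ℂ) = μ.1 b := by
  rw [← Complex.conj_eq_iff_re, ← apply_star μ.2.1, hb.star_eq]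

theorem sub_mem_ballAt (hb : b ∈ L.unitBall) (μ : State A) : b - μ.1 b • 1 ∈ L.ballAt μ := by
  constructor
  · have h := add_smul_one_mem_unitBall hb (-(μ.1 b).re)
    rwa [Complex.ofReal_neg, ofReal_re_apply (isSelfAdjoint_of_mem_unitBall hb), neg_smul,
      ← sub_eq_add_neg] at h
  · rw [map_sub, State.apply_smul_one, sub_self]

/-- The metric tests only elements of `A`, but subtracting the scalar part changes neither
membership in the unit ball nor `φ(b) - ψ(b)`. -/
theorem enorm_sub_le_dist (hb : b ∈ L.unitBall) (φ ψ : State A) :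
    ‖φ.1 b - ψ.1 b‖ₑ ≤ L.dist φ ψ := by
  obtain ⟨a, r, rfl⟩ := exists_eq_incl_add_real (isSelfAdjoint_of_mem_unitBall hb)
  have h := add_smul_one_mem_unitBall hb (-r)
  rw [Complex.ofReal_neg, neg_smul, add_neg_cancel_right] at h
  rw [map_add, map_add, State.apply_smul_one, State.apply_smul_one, add_sub_add_right_eq_sub]
  exact le_iSup₂ (f := fun b (_ : b ∈ {b ∈ L.unitBall | b ∈ Set.range (incl A)}) =>
    ‖φ.1 b - ψ.1 b‖ₑ) (incl A a) ⟨h, a, rfl⟩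

theorem norm_sub_le_of_dist_le (hb : b ∈ L.unitBall) {φ ψ : State A} {c : ℝ} (hc : 0 ≤ c)
    (h : L.dist φ ψ ≤ ENNReal.ofReal c) : ‖φ.1 b - ψ.1 b‖ ≤ c := by
  have := (enorm_sub_le_dist hb φ ψ).trans h
  rwa [← ofReal_norm, ENNReal.ofReal_le_ofReal_iff hc] at this

theorem dist_le_of_forall {φ ψ : State A} {c : ℝ}
    (h : ∀ b ∈ L.unitBall, ‖φ.1 b - ψ.1 b‖ ≤ c) : L.dist φ ψ ≤ ENNReal.ofReal c :=
  iSup₂_le fun b hb => by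
    rw [← ofReal_norm]
    exact ENNReal.ofReal_le_ofReal (h b hb.1)

theorem norm_le_of_mem_ballAt {μ φ : State A} (hb : b ∈ L.ballAt μ) {c : ℝ} (hc : 0 ≤ c)
    (h : L.dist φ μ ≤ ENNReal.ofReal c) : ‖φ.1 b‖ ≤ c := by
  have := norm_sub_le_of_dist_le hb.1 hc h
  rwa [hb.2, sub_zero] at this

/-- The Monge-Kantorovich topology is finer than the weak* topology. -/
theorem mkTopology_le_weakStarTopology (L : LipschitzSeminorm A) :
    L.mkTopology ≤ weakStarTopology A := by
  let _ := L.mkEMetric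
  rw [← continuous_iff_le_induced]
  refine continuous_pi fun a => ?_
  have h1 : ∀ b : selfAdjoint (MinUnitization A),
      Continuous fun φ : State A => φ.1 (b : MinUnitization A) := by
    intro b
    have hd : ∀ c ∈ L.domain, Continuous fun φ : State A => φ.1 (c : MinUnitization A) := by
      intro c hc
      -- The added `1` keeps the constant invertible when the seminorm vanishes.
      have : LipschitzWith (L.seminorm ⟨c, hc⟩ + 1).toNNReal
          fun φ : State A => φ.1 (c : MinUnitization A) := by
        intro φ ψ
        have hp : 0 < L.seminorm ⟨c, hc⟩ + 1 := by positivity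
        set l := L.seminorm ⟨c, hc⟩ + 1 with hl
        have hm : (((l⁻¹ : ℝ) : ℂ) • (c : MinUnitization A)) ∈ L.unitBall := by
          refine ⟨l⁻¹ • c, L.domain.smul_mem _ hc, ?_, ?_⟩
          · change L.seminorm (l⁻¹ • ⟨c, hc⟩) ≤ 1
            rw [map_smul_eq_mul, Real.norm_of_nonneg (inv_nonneg.2 hp.le), inv_mul_le_one₀ hp]
            linarith
          · rw [Complex.coe_smul]
            rfl
        have h2 := enorm_sub_le_dist hm φ ψ
        rw [map_smul, map_smul, ← smul_sub, enorm_smul] at h2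
        rw [edist_eq_enorm_sub]
        change _ ≤ _ * L.dist φ ψ
        refine le_trans (le_of_eq ?_) (mul_le_mul_right h2 _)
        rw [← mul_assoc, ← ofReal_norm ((l⁻¹ : ℝ) : ℂ), Complex.norm_real,
          Real.norm_of_nonneg (inv_nonneg.2 hp.le)]
        change _ = ENNReal.ofReal l * _ * _
        rw [← ENNReal.ofReal_mul hp.le, mul_inv_cancel₀ hp.ne', ENNReal.ofReal_one, one_mul]
      exact this.continuous
    obtain ⟨u, hu, hub⟩ := mem_closure_iff_seq_limit.1 (L.dense_domain b)
    -- States are contractive, so norm approximation of `b` from the domain is uniform over all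
    -- states.
    refine TendstoUniformly.continuous (F := fun n (φ : State A) => φ.1 (u n : MinUnitization A))
      (p := atTop) ?_ (Frequently.of_forall fun n => hd _ (hu n))
    rw [Metric.tendstoUniformly_iff]
    intro ε hε
    filter_upwards [(Metric.tendsto_nhds.1 hub) ε hε] with n hn φ
    rw [dist_eq_norm, ← map_sub]
    refine (norm_apply_le φ.2.1 φ.2.2.1 _).trans_lt ?_
    rw [dist_comm] at hn
    rwa [Subtype.dist_eq, dist_eq_norm] at hn
  have h2 := (h1 (realPart (incl A a))).add ((h1 (imaginaryPart (incl A a))).const_mul Complex.I)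
  refine h2.congr fun φ => ?_
  conv_rhs => rw [← realPart_add_I_smul_imaginaryPart (incl A a), map_add, map_smul]
  rfl

end LipschitzSeminorm

end Seminorm

namespace Topography

/-! ### Strictly positive elements on the spectrum -/

section StrictlyPositive

variable {A : Type*} [NonUnitalCStarAlgebra A] {M : Topography A} {h : M.alg}

theorem re_character_pos (hh : StrictlyPositiveElement h) (x : M.spec) : 0 < (x h).re := by
  have h1 := hh.2 (WeakDual.toStrongDual (x : WeakDual ℂ M.alg)) (fun m => by
    change 0 ≤ x (star m * m)
    rw [character_star_mul_self]
    exact Complex.zero_le_real.2 (by positivity)) (by simpa using x.2.1)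
  exact (Complex.pos_iff.1 h1).1

theorem exists_le_re_character (hh : StrictlyPositiveElement h)
    (K : TopologicalSpace.Compacts M.spec) : ∃ δ > 0, ∀ x ∈ K, δ ≤ (x h).re := by
  have hc : Continuous fun x : M.spec => (x h).re :=
    Complex.continuous_re.comp ((WeakDual.eval_continuous h).comp continuous_subtype_val)
  rcases (K : Set M.spec).eq_empty_or_nonempty with hK | hK
  · refine ⟨1, one_pos, fun x hx => ?_⟩
    have : x ∈ (K : Set M.spec) := hx
    rw [hK] at this
    exact this.elim
  · obtain ⟨y, -, hy⟩ := K.isCompact.exists_isMinOn hK hc.continuousOn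
    exact ⟨(y h).re, re_character_pos hh y, fun x hx => hy hx⟩

theorem StrictlyPositive.isSelfAdjoint (hh : StrictlyPositiveElement h) : IsSelfAdjoint h := by
  obtain ⟨k, rfl⟩ := hh.1
  exact .star_mul_self k

/-- The ramp vanishes below `s > 0`, so dividing it by `max r s` gives a continuous quotient whose
product with `r` is the ramp. -/
theorem rampOf_eq_mul (hh : IsSelfAdjoint h) {s t : ℝ} (hs : 0 < s) (hst : s < t) :
    ∃ g : M.alg, rampOf h s t = g * h ∧ rampOf h s t = h * g := by
  let G : ℝ → ℝ := fun r => ramp s t r / max r s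
  have hG : Continuous G := continuous_ramp.div (by fun_prop) fun r =>
    (hs.trans_le (le_max_right _ _)).ne'
  have hG0 : G 0 = 0 := by simp [G, ramp_of_le hst hs.le]
  have hGr : ∀ r, G r * r = ramp s t r := by
    intro r
    rcases le_total r s with h | h
    · simp [G, ramp_of_le hst h]
    · simp only [G]
      rw [max_eq_left h]
      have : 0 < r := hs.trans_le h
      field_simp
  have e1 : rampOf h s t = cfcₙ G h * h := by
    have h2 := cfcₙ_mul G (fun r => r) h hG.continuousOn hG0
    rw [cfcₙ_id' ℝ h] at h2
    rw [← h2]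
    exact cfcₙ_congr fun r _ => (hGr r).symm
  exact ⟨cfcₙ G h, e1, e1.trans (Subtype.ext (M.mul_comm _ (cfcₙ G h).2 _ h.2))⟩

variable [PartialOrder A] [StarOrderedRing A]

theorem nonempty_majorant (hh : StrictlyPositiveElement h)
    (K : TopologicalSpace.Compacts M.spec) : Nonempty (M.Majorant K) := by
  obtain ⟨δ, hδ, hK⟩ := exists_le_re_character hh K
  exact ⟨rampMajorant (StrictlyPositive.isSelfAdjoint hh) (half_pos hδ).le (half_lt_self hδ) hK⟩

end StrictlyPositive

end Topography
end

noncomputable section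

attribute [local instance] isClosed_minUnitization Topography.isClosed_alg

/-! ### Estimates for compressions -/

section Aux

variable {A : Type*} [NonUnitalCStarAlgebra A]

theorem totallyBounded_image_mul_mul {S : Set (MinUnitization A)} (hS : TotallyBounded S)
    (g k : MinUnitization A) : TotallyBounded ((fun z => g * z * k) '' S) :=
  hS.image (ContinuousLinearMap.mulLeftRight ℂ (MinUnitization A) g k).uniformContinuous

theorem exists_norm_le_of_totallyBounded {E : Type*} [SeminormedAddCommGroup E] {S : Set E}
    (hS : TotallyBounded S) : ∃ C, 0 ≤ C ∧ ∀ z ∈ S, ‖z‖ ≤ C := by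
  obtain ⟨C, hC⟩ := hS.isBounded.exists_norm_le
  exact ⟨max C 0, le_max_right _ _, fun z hz => (hC z hz).trans (le_max_left _ _)⟩

theorem norm_apply_incl_mul_le {ψ : StrongDual ℂ (MinUnitization A)}
    (hψ : ∀ b, 0 ≤ ψ (star b * b)) (h1 : ψ 1 = 1) {d : A} (hd : IsSelfAdjoint d) {η : ℝ}
    (hη : (ψ (incl A (d * d))).re ≤ η) (y : MinUnitization A) :
    ‖ψ (incl A d * y)‖ ≤ √η * ‖y‖ ∧ ‖ψ (y * incl A d)‖ ≤ √η * ‖y‖ := by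
  have hs : star (incl A d) = incl A d := by rw [← incl_star, hd.star_eq]
  have hη0 : 0 ≤ η := by
    refine le_trans ?_ hη
    have := (Complex.nonneg_iff.1 (hψ (incl A d))).1
    rwa [hs, ← incl_mul] at this
  constructor
  · refine le_of_sq_le_sq ?_ (by positivity)
    have h := norm_apply_mul_sq_le hψ (incl A d) y
    rw [hs, ← incl_mul] at h
    rw [mul_pow, Real.sq_sqrt hη0]
    exact h.trans (mul_le_mul hη (apply_star_mul_self_le hψ h1 y)
      (Complex.nonneg_iff.1 (hψ y)).1 hη0)
  · refine le_of_sq_le_sq ?_ (by positivity)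
    have h := norm_apply_mul_sq_le hψ (star y) (incl A d)
    rw [hs, ← incl_mul, star_star] at h
    rw [mul_pow, Real.sq_sqrt hη0, mul_comm]
    have h2 := apply_star_mul_self_le hψ h1 (star y)
    rw [star_star, norm_star] at h2
    refine h.trans (mul_le_mul h2 hη ?_ (sq_nonneg _))
    have := (Complex.nonneg_iff.1 (hψ (incl A d))).1
    rwa [hs, ← incl_mul] at this

theorem mul_le_left_of_commute [PartialOrder A] [StarOrderedRing A] {f g : A} (hf : 0 ≤ f)
    (hg : 0 ≤ g) (hg1 : ‖g‖ ≤ 1) (hc : Commute g f) : f * g ≤ f := by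
  have hs : Commute g (CFC.sqrt f) := (hc.symm.cfcₙ_nnreal (f := NNReal.sqrt)).symm
  have hsa : star (CFC.sqrt f) = CFC.sqrt f :=
    (IsSelfAdjoint.of_nonneg (CFC.sqrt_nonneg _)).star_eq
  have h1 := CStarAlgebra.star_left_conjugate_le_norm_smul (a := CFC.sqrt f) (b := g)
    (IsSelfAdjoint.of_nonneg hg)
  rw [hsa, mul_assoc, hs.eq, ← mul_assoc, CFC.sqrt_mul_sqrt_self f hf] at h1
  refine h1.trans ?_
  calc ‖g‖ • f ≤ (1 : ℝ) • f := smul_le_smul_of_nonneg_right hg1 hf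
    _ = f := one_smul _ _

end Aux

variable {A : Type*} [NonUnitalCStarAlgebra A] [PartialOrder A] [StarOrderedRing A]
  {L : LipschitzSeminorm A} {M : Topography A}

/-! ### Change of base state, and regularity -/

namespace Topography

/-- Any two local states are at a finite distance in a regular triple. -/
theorem exists_dist_le (hne : ∀ K, Nonempty (M.Majorant K)) (hR : IsRegular L M)
    {μ : State A} (hμ : μ ∈ M.localStates) (K : TopologicalSpace.Compacts M.spec) :
    ∃ c, 0 ≤ c ∧ ∀ φ ∈ M.statesOn K, L.dist φ μ ≤ ENNReal.ofReal c := by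
  obtain ⟨K', hK'⟩ := Set.mem_iUnion.1 hμ
  refine ⟨_, ENNReal.toReal_nonneg (a := (⨆ φ ∈ M.statesOn (K ⊔ K'), ⨆ ψ ∈ M.statesOn (K ⊔ K'),
    L.dist φ ψ)), fun φ hφ => ?_⟩
  rw [ENNReal.ofReal_toReal (hR (K ⊔ K')).ne]
  have h1 := statesOn_mono (le_sup_left : K ≤ K ⊔ K') hφ
  have h2 := statesOn_mono (le_sup_right : K' ≤ K ⊔ K') hK'
  exact (le_iSup₂ (f := fun ψ (_ : ψ ∈ M.statesOn (K ⊔ K')) => L.dist φ ψ) μ h2).trans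
    (le_iSup₂ (f := fun φ (_ : φ ∈ M.statesOn (K ⊔ K')) => ⨆ ψ ∈ M.statesOn (K ⊔ K'), L.dist φ ψ)
      φ h1)

/-- Write `a = (a - μ(a)1) + μ(a)1`. Regularity bounds `|μ(a)|` on the ball at `ν`, so the
compressions lie in a compact set plus a disc times `h²`. -/
theorem totallyBounded_ballAt_change (hne : ∀ K, Nonempty (M.Majorant K)) (hR : IsRegular L M)
    {h : M.alg} {μ ν : State A} (hμ : μ ∈ M.localStates) (hν : ν ∈ M.localStates)
    (hT : TotallyBounded ((fun a => incl A h * a * incl A h) '' L.ballAt μ)) :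
    TotallyBounded ((fun a => incl A h * a * incl A h) '' L.ballAt ν) := by
  obtain ⟨K, hK⟩ := Set.mem_iUnion.1 hμ
  obtain ⟨c, hc, hcν⟩ := exists_dist_le hne hR hν K
  have h1 : IsCompact (closure ((fun a => incl A h * a * incl A h) '' L.ballAt μ)) :=
    hT.closure.isCompact_of_isClosed isClosed_closure
  have h2 : IsCompact ((fun z : ℂ => z • (incl A (h : A) * incl A h)) ''
      Metric.closedBall (0 : ℂ) c) :=
    (isCompact_closedBall _ _).image (by fun_prop)
  refine (h1.add h2).totallyBounded.subset ?_
  rintro _ ⟨a, ha, rfl⟩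
  refine ⟨_, subset_closure ⟨_, LipschitzSeminorm.sub_mem_ballAt ha.1 μ, rfl⟩, _,
    ⟨μ.1 a, ?_, rfl⟩, ?_⟩
  · rw [mem_closedBall_zero_iff]
    exact LipschitzSeminorm.norm_le_of_mem_ballAt ha hc (hcν μ hK)
  · simp only [mul_sub, sub_mul, mul_smul_comm, smul_mul_assoc, mul_one, sub_add_cancel]

section StrictlyPositive

variable {h : M.alg} {μ : State A}

omit [PartialOrder A] [StarOrderedRing A] in
theorem exists_ramp_mul_mul_eq (hh : StrictlyPositiveElement h) {s t : ℝ} (hs : 0 < s)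
    (hst : s < t) : ∃ g : A, ∀ a, incl A (rampOf h s t) * a * incl A (rampOf h s t) =
      incl A g * (incl A h * a * incl A h) * incl A g := by
  obtain ⟨g, h1, h2⟩ := rampOf_eq_mul (StrictlyPositive.isSelfAdjoint hh) hs hst
  refine ⟨g, fun a => ?_⟩
  have e1 : incl A (rampOf h s t : A) = incl A g * incl A h := by
    rw [← incl_mul]; exact congrArg (fun m : M.alg => incl A (m : A)) h1
  have e2 : incl A (rampOf h s t : A) = incl A h * incl A g := by
    rw [← incl_mul]; exact congrArg (fun m : M.alg => incl A (m : A)) h2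
  conv_lhs => rw [e1]
  rw [← e1]
  conv_lhs => rw [e1]; arg 2; rw [← e1, e2]
  simp only [mul_assoc]

omit [PartialOrder A] [StarOrderedRing A] in
theorem totallyBounded_ramp (hh : StrictlyPositiveElement h)
    (hT : TotallyBounded ((fun a => incl A h * a * incl A h) '' L.ballAt μ)) {s t : ℝ} (hs : 0 < s)
    (hst : s < t) : TotallyBounded
      ((fun a => incl A (rampOf h s t) * a * incl A (rampOf h s t)) '' L.ballAt μ) := by
  obtain ⟨g, hg⟩ := exists_ramp_mul_mul_eq hh hs hst
  have := totallyBounded_image_mul_mul hT (incl A g) (incl A g)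
  rw [Set.image_image] at this
  simpa only [hg] using this

theorem isRegular_of_totallyBounded (hh : StrictlyPositiveElement h)
    (hT : TotallyBounded ((fun a => incl A h * a * incl A h) '' L.ballAt μ)) : IsRegular L M := by
  intro K
  obtain ⟨δ, hδ, hK⟩ := exists_le_re_character hh K
  have := nonempty_majorant hh K
  obtain ⟨C, hC, hCb⟩ := exists_norm_le_of_totallyBounded
    (totallyBounded_ramp hh hT (half_pos hδ) (half_lt_self hδ))
  let g : M.Majorant K :=
    rampMajorant (StrictlyPositive.isSelfAdjoint hh) (half_pos hδ).le (half_lt_self hδ) hK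
  have hb : ∀ φ ∈ M.statesOn K, ∀ a ∈ L.ballAt μ, ‖φ.1 a‖ ≤ C := fun φ hφ a ha => by
    rw [← apply_majorant_mul_mul hφ g g]
    exact (norm_apply_le φ.2.1 φ.2.2.1 _).trans (hCb _ ⟨a, ha, rfl⟩)
  refine lt_of_le_of_lt (b := ENNReal.ofReal (C + C)) ?_ ENNReal.ofReal_lt_top
  refine iSup₂_le fun φ hφ => iSup₂_le fun ψ hψ =>
    LipschitzSeminorm.dist_le_of_forall fun b hb' => ?_
  have h1 := hb φ hφ _ (LipschitzSeminorm.sub_mem_ballAt hb' μ)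
  have h2 := hb ψ hψ _ (LipschitzSeminorm.sub_mem_ballAt hb' μ)
  have h3 : φ.1 b - ψ.1 b = φ.1 (b - μ.1 b • 1) - ψ.1 (b - μ.1 b • 1) := by
    rw [map_sub, map_sub, State.apply_smul_one, State.apply_smul_one,
      sub_sub_sub_cancel_right]
  rw [h3]
  exact (norm_sub_le _ _).trans (add_le_add h1 h2)

end StrictlyPositive

end Topography
end

/-! ### From total boundedness to equality of topologies on tame sets -/

noncomputable section

attribute [local instance] isClosed_minUnitization Topography.isClosed_alg

theorem exists_sub_le_inv {r : ℕ → ℝ} {N : ℕ} (hN : 0 < N) (h0 : r 0 ≤ 1) (h1 : 0 ≤ r N) :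
    ∃ i < N, r i - r (i + 1) ≤ 1 / N := by
  by_contra! H
  have hN' : (0 : ℝ) < N := Nat.cast_pos.2 hN
  have h2 : ∑ _i ∈ Finset.range N, (1 / N : ℝ) < ∑ i ∈ Finset.range N, (r i - r (i + 1)) :=
    Finset.sum_lt_sum_of_nonempty (Finset.nonempty_range_iff.2 hN.ne')
      fun i hi => H i (Finset.mem_range.1 hi)
  rw [Finset.sum_range_sub', Finset.sum_const, Finset.card_range, nsmul_eq_mul,
    mul_one_div_cancel hN'.ne'] at h2
  linarith

variable {A : Type*} [NonUnitalCStarAlgebra A] [PartialOrder A] [StarOrderedRing A]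
  {L : LipschitzSeminorm A} {M : Topography A}

namespace Topography

/-- Majorants of the level set at `t` that lie below the ramp `f₂` on `[s, t]` dominate the ramp on
`[t, u]`, so `ψ` sees them within `η` of `f₂`. The ramp on `[q, p]` is a unit for all of them and
replaces the possibly large `a` by an element of norm at most `C`. -/
theorem norm_corner_sub_ramp_le {h : M.alg} (hh : IsSelfAdjoint h) (ψ : State A) {q p s t u : ℝ}
    (hq : 0 < q) (hqp : q < p) (hps : p ≤ s) (hst : s < t) (htu : t < u) (ht : 0 < t) {η C : ℝ}
    (hη : (ψ.1 (incl A (rampOf h s t))).re - (ψ.1 (incl A (rampOf h t u))).re ≤ η)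
    {a : MinUnitization A} (hC : ‖incl A (rampOf h q p) * a * incl A (rampOf h q p)‖ ≤ C) :
    ‖M.corner (level h ht) a ψ.1 - ψ.1 (incl A (rampOf h s t) * a * incl A (rampOf h s t))‖ ≤
      2 * C * √η := by
  have hs : 0 < s := hq.trans (hqp.trans_le hps)
  let f₂ : M.Majorant (level h ht) := rampMajorant hh hs.le hst fun x hx => hx
  have : Nonempty (M.Majorant (level h ht)) := ⟨f₂⟩
  set ρ : M.alg := rampOf h q p with hρ
  -- `ρ` acts as a unit on majorants below `f₂`
  have hunit : ∀ f : M.Majorant (level h ht), f₂ ≤ f → ρ * f.1 = f.1 := by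
    intro f hf
    refine eq_of_character_eq fun x => ?_
    rw [character_mul, hρ, character_rampOf hh hq.le hqp]
    rcases le_total (x h).re s with hx | hx
    · have h1 : (x f.1).re ≤ (x (rampOf h s t)).re := re_character_mono x hf
      rw [character_rampOf hh hs.le hst, ramp_of_le hst hx, Complex.ofReal_zero, Complex.zero_re]
        at h1
      rw [← ofReal_re_character x f.2.1, le_antisymm h1 (re_character_nonneg x f.2.1),
        Complex.ofReal_zero, mul_zero]
    · rw [ramp_of_ge hqp (hps.trans hx), Complex.ofReal_one, one_mul]
  have hunitA : ∀ f : M.Majorant (level h ht), f₂ ≤ f →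
      incl A ρ * incl A f.1 = incl A f.1 ∧ incl A f.1 * incl A ρ = incl A f.1 := by
    intro f hf
    have e : (ρ : A) * (f.1 : A) = f.1 := congrArg (fun m : M.alg => (m : A)) (hunit f hf)
    refine ⟨by rw [← incl_mul, e], ?_⟩
    rw [← incl_mul, M.mul_comm _ f.1.2 _ ρ.2, e]
  set b := incl A ρ * a * incl A ρ with hb
  have hsandwich : ∀ f g : M.Majorant (level h ht), f₂ ≤ f → f₂ ≤ g →
      incl A f.1 * a * incl A g.1 = incl A f.1 * b * incl A g.1 := by
    intro f g hf hg
    calc incl A f.1 * a * incl A g.1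
        = (incl A f.1 * incl A ρ) * a * (incl A ρ * incl A g.1) := by
          rw [(hunitA f hf).2, (hunitA g hg).1]
      _ = _ := by rw [hb]; simp only [mul_assoc]
  -- the difference of majorants is small at `ψ`
  have hsmall : ∀ f : M.Majorant (level h ht), f₂ ≤ f →
      (ψ.1 (incl A (((f₂.1 : A) - f.1) * ((f₂.1 : A) - f.1)))).re ≤ η := by
    intro f hf
    have hd : 0 ≤ (f₂.1 : A) - f.1 := sub_nonneg.2 hf
    have hd1 : ‖(f₂.1 : A) - f.1‖ ≤ 1 :=
      (CStarAlgebra.norm_le_norm_of_nonneg_of_le hd (sub_le_self _ f.2.1)).trans f₂.2.2.1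
    -- For `0 ≤ d ≤ 1`, `d² ≤ d` turns the linear bound on `ψ(d)` into the quadratic one needed for
    -- Cauchy-Schwarz.
    have h1 := apply_incl_mono ψ.2.1 (mul_le_left_of_commute hd hd hd1 (Commute.refl _))
    have h2 : (rampOf h t u : A) ≤ f.1 := by
      have e : (f.1 : A) * (rampOf h t u : A) = rampOf h t u :=
        congrArg (fun m : M.alg => (m : A)) (f.mul_eq (rampOf_supportedIn hh ht htu))
      rw [← e]
      exact mul_le_left_of_commute f.2.1 (rampOf_nonneg ht.le htu) norm_rampOf_le
        (M.mul_comm _ (rampOf h t u).2 _ f.1.2)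
    have h3 := apply_incl_mono ψ.2.1 h2
    rw [map_sub, map_sub, Complex.sub_re] at h1
    exact h1.trans (by
      change _ ≤ _ at hη
      have : f₂.1 = rampOf h s t := rfl
      rw [this]
      linarith)
  refine norm_corner_sub_le ψ a _ f₂ fun f g hf hg => ?_
  have hn : ∀ k : M.Majorant (level h ht), ‖incl A (k.1 : A)‖ ≤ 1 := fun k => by
    rw [(incl A).norm_map]; exact k.2.2.1
  have hdsa : ∀ k : M.Majorant (level h ht), IsSelfAdjoint ((f₂.1 : A) - k.1) :=
    fun k => f₂.isSelfAdjoint.sub k.isSelfAdjoint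
  have hb0 : ‖b * incl A g.1‖ ≤ C :=
    (norm_mul_le _ _).trans ((mul_le_of_le_one_right (norm_nonneg _) (hn g)).trans hC)
  have hb1 : ‖incl A f₂.1 * b‖ ≤ C :=
    (norm_mul_le _ _).trans ((mul_le_of_le_one_left (norm_nonneg _) (hn f₂)).trans hC)
  have e1 := (norm_apply_incl_mul_le ψ.2.1 ψ.2.2.1 (hdsa f) (hsmall f hf) (b * incl A g.1)).1
  have e2 := (norm_apply_incl_mul_le ψ.2.1 ψ.2.2.1 (hdsa g) (hsmall g hg) (incl A f₂.1 * b)).2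
  have e3 : ψ.1 (incl A f.1 * a * incl A g.1) -
      ψ.1 (incl A (rampOf h s t) * a * incl A (rampOf h s t)) =
      -ψ.1 (incl A ((f₂.1 : A) - f.1) * (b * incl A g.1)) -
        ψ.1 (incl A f₂.1 * b * incl A ((f₂.1 : A) - g.1)) := by
    have : f₂.1 = rampOf h s t := rfl
    rw [← this, hsandwich f g hf hg, hsandwich f₂ f₂ le_rfl le_rfl, map_sub (incl A),
      map_sub (incl A), ← map_neg, ← map_sub, ← map_sub]
    congr 1
    noncomm_ring
  rw [e3]
  refine (norm_sub_le _ _).trans ?_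
  rw [norm_neg]
  have e4 : √η * ‖b * incl A g.1‖ ≤ √η * C := by gcongr
  have e5 : √η * ‖incl A f₂.1 * b‖ ≤ √η * C := by gcongr
  linarith

/-- A basic weak* neighbourhood of `φ` in the tame set is made `mk_L`-small. The constant is `7 = 2
+ 2 + 1 + 1 + 1`: cutting down for `φ` and `ψ`, net approximation for each, and comparison on the
net. -/
theorem exists_finset_of_isTame {h : M.alg} (hh : StrictlyPositiveElement h)
    (hT : ∀ μ ∈ M.localStates, TotallyBounded ((fun a => incl A h * a * incl A h) '' L.ballAt μ))
    {S : Set (State A)} (hS : IsTame L M S) {φ : State A} (hφ : φ ∈ S) {ε : ℝ} (hε : 0 < ε) :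
    ∃ (F : Finset A) (δ : ℝ), 0 < δ ∧ ∀ ψ ∈ S, (∀ c ∈ F, ‖ψ.1 (incl A c) - φ.1 (incl A c)‖ < δ) →
      ∀ a ∈ L.unitBall, ‖φ.1 a - ψ.1 a‖ ≤ 7 * ε := by
  obtain ⟨ν, hν, htame⟩ := hS
  have hsa := StrictlyPositive.isSelfAdjoint hh
  have htame' : ∀ᶠ K : TopologicalSpace.Compacts M.spec in atTop, ∀ ψ ∈ S, ∀ a ∈ L.ballAt ν,
      ‖ψ.1 a - M.corner K a ψ.1‖ ≤ ε := by
    have h1 := htame.eventually (Iic_mem_nhds (ENNReal.ofReal_pos.2 hε))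
    filter_upwards [h1] with K hK ψ hψ a ha
    have h2 : ‖ψ.1 a - M.corner K a ψ.1‖ₑ ≤ ENNReal.ofReal ε :=
      ((le_iSup₂ (f := fun a (_ : a ∈ L.ballAt ν) => ‖ψ.1 a - M.corner K a ψ.1‖ₑ) a ha).trans
      (le_iSup₂ (f := fun ψ (_ : ψ ∈ S) => ⨆ a ∈ L.ballAt ν, ‖ψ.1 a - M.corner K a ψ.1‖ₑ)
        ψ hψ)).trans hK
    rwa [← ofReal_norm, ENNReal.ofReal_le_ofReal_iff hε.le] at h2
  obtain ⟨K₀, hK₀⟩ := eventually_atTop.1 htame'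
  obtain ⟨δ, hδ, hδK⟩ := exists_le_re_character hh K₀
  have hqp : δ / 4 < δ / 2 := by linarith
  -- The outer ramp on `[δ/4, δ/2]` is fixed first, so `C` does not depend on the number `N` of
  -- ramps chosen next.
  obtain ⟨C, hC, hCb⟩ := exists_norm_le_of_totallyBounded
    (totallyBounded_ramp hh (hT ν hν) (by positivity : 0 < δ / 4) hqp)
  obtain ⟨N, hN0, hN⟩ : ∃ N : ℕ, 0 < N ∧ 2 * C * √(2 / N) ≤ ε := by
    have h1 : Tendsto (fun N : ℕ => 2 * C * √(2 / N)) atTop (𝓝 (2 * C * √0)) :=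
      ((tendsto_const_div_atTop_nhds_zero_nat 2).sqrt).const_mul _
    rw [Real.sqrt_zero, mul_zero] at h1
    obtain ⟨N, h2, h3⟩ := ((h1.eventually (Iic_mem_nhds hε)).and (eventually_gt_atTop 0)).exists
    exact ⟨N, h3, h2⟩
  have hN1 : (0 : ℝ) < N + 1 := by positivity
  -- The nodes run from `δ/2` at `0` to `δ` at `N + 1`. Two consecutive ramps use three nodes, hence
  -- `N + 1`; every level set used contains `K₀`.
  let t : ℕ → ℝ := fun i => δ / 2 * (1 + i / (N + 1))
  have htmono : ∀ i, t i < t (i + 1) := fun i => by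
    simp only [t]
    push_cast
    gcongr
    linarith
  have htlow : ∀ i, δ / 2 ≤ t i := fun i => by
    simp only [t]
    refine le_mul_of_one_le_right (by positivity) ?_
    have : (0 : ℝ) ≤ i / (N + 1) := by positivity
    linarith
  have hthigh : ∀ i ≤ N + 1, t i ≤ δ := fun i hi => by
    have : (i : ℝ) / (N + 1) ≤ 1 := (div_le_one hN1).2 (by exact_mod_cast hi)
    simp only [t]
    nlinarith
  have htpos : ∀ i, 0 < t i := fun i => (half_pos hδ).trans_le (htlow i)
  obtain ⟨i, hi, hiN⟩ := exists_sub_le_inv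
    (r := fun i => (φ.1 (incl A (rampOf h (t i) (t (i + 1))))).re) hN0
    ((Complex.re_le_norm _).trans ((norm_apply_le φ.2.1 φ.2.2.1 _).trans (by
      rw [(incl A).norm_map]; exact norm_rampOf_le)))
    (Complex.nonneg_iff.1 (apply_incl_nonneg φ.2.1 (rampOf_nonneg (htpos N).le (htmono N)))).1
  set f₂ := rampOf h (t i) (t (i + 1)) with hf₂
  set f₁ := rampOf h (t (i + 1)) (t (i + 1 + 1)) with hf₁
  have hKle : K₀ ≤ level h (htpos (i + 1)) := fun x hx =>
    (hthigh (i + 1) (by omega)).trans (hδK x hx)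
  obtain ⟨T, hTsub, hTfin, hTcov⟩ := Metric.finite_approx_of_totallyBounded
    (totallyBounded_ramp hh (hT ν hν) (htpos i) (htmono i)) ε hε
  have hchoose : ∀ z : MinUnitization A, ∃ c : A, z ∈ T → z = incl A c := fun z => by
    by_cases hz : z ∈ T
    · obtain ⟨a, -, rfl⟩ := hTsub hz
      obtain ⟨c, hc⟩ := exists_incl_mul_mul (f₂ : A) f₂ a
      exact ⟨c, fun _ => hc⟩
    · exact ⟨0, fun h => (hz h).elim⟩
  choose c hc using hchoose
  have hN' : (0 : ℝ) < 1 / N := by positivity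
  classical
  -- Testing `f₂ - f₁` carries the small drop from `φ` over to `ψ`, at most doubling it to `2 / N`;
  -- the other elements are the net of `f₂ 𝔏₁ f₂`.
  refine ⟨insert ((f₂ : A) - f₁) (hTfin.toFinset.image c), min (1 / N) ε, lt_min hN' hε, ?_⟩
  intro ψ hψ hψF a ha
  have hcut : ∀ χ ∈ S, (χ.1 (incl A f₂)).re - (χ.1 (incl A f₁)).re ≤ 2 / N → ∀ b ∈ L.ballAt ν,
      ‖χ.1 b - χ.1 (incl A f₂ * b * incl A f₂)‖ ≤ 2 * ε := by
    intro χ hχ hχN b hb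
    have h1 := hK₀ _ hKle χ hχ b hb
    have h2 := norm_corner_sub_ramp_le hsa χ (by positivity) hqp (htlow i) (htmono i)
      (htmono (i + 1)) (htpos (i + 1)) hχN (hCb _ ⟨b, hb, rfl⟩)
    calc _ ≤ ‖χ.1 b - M.corner (level h (htpos (i + 1))) b χ.1‖ +
          ‖M.corner (level h (htpos (i + 1))) b χ.1 - χ.1 (incl A f₂ * b * incl A f₂)‖ :=
        norm_sub_le_norm_sub_add_norm_sub _ _ _
      _ ≤ ε + ε := add_le_add h1 (h2.trans hN)
      _ = 2 * ε := by ring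
  have hφN : (φ.1 (incl A f₂)).re - (φ.1 (incl A f₁)).re ≤ 2 / N := by
    refine hiN.trans ?_
    gcongr
    norm_num
  have hψN : (ψ.1 (incl A f₂)).re - (ψ.1 (incl A f₁)).re ≤ 2 / N := by
    have h1 := (hψF _ (Finset.mem_insert_self _ _)).trans_le (min_le_left _ _)
    have h2 := (Complex.re_le_norm _).trans h1.le
    simp only [map_sub, Complex.sub_re] at h2
    have h3 : (2 : ℝ) / N = 1 / N + 1 / N := by ring
    rw [h3]
    linarith
  have hb := LipschitzSeminorm.sub_mem_ballAt ha ν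
  set b := a - ν.1 a • 1
  have h1 := hcut φ hφ hφN b hb
  have h2 := hcut ψ hψ hψN b hb
  obtain ⟨z, hz, hzb⟩ := Set.mem_iUnion₂.1 (hTcov ⟨b, hb, rfl⟩)
  rw [Metric.mem_ball, dist_eq_norm] at hzb
  have h3 : ∀ χ : State A, ‖χ.1 (incl A f₂ * b * incl A f₂) - χ.1 z‖ ≤ ε := fun χ => by
    rw [← map_sub]
    exact (norm_apply_le χ.2.1 χ.2.2.1 _).trans hzb.le
  have h4 : ‖ψ.1 z - φ.1 z‖ ≤ ε := by
    rw [hc z hz]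
    exact ((hψF _ (Finset.mem_insert_of_mem (Finset.mem_image_of_mem _
      (hTfin.mem_toFinset.2 hz)))).trans_le (min_le_right _ _)).le
  have h5 : φ.1 a - ψ.1 a = (φ.1 b - φ.1 (incl A f₂ * b * incl A f₂)) -
      (ψ.1 b - ψ.1 (incl A f₂ * b * incl A f₂)) + (φ.1 (incl A f₂ * b * incl A f₂) - φ.1 z) -
      (ψ.1 (incl A f₂ * b * incl A f₂) - ψ.1 z) - (ψ.1 z - φ.1 z) := by
    simp only [b, map_sub, State.apply_smul_one]
    ring
  rw [h5]
  calc _ ≤ _ := norm_sub_le _ _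
    _ ≤ _ := add_le_add_left (norm_sub_le _ _) _
    _ ≤ _ := add_le_add_left (add_le_add_left (norm_add_le _ _) _) _
    _ ≤ _ := add_le_add_left (add_le_add_left (add_le_add_left (norm_sub_le _ _) _) _) _
    _ ≤ 7 * ε := by linarith [h3 φ, h3 ψ]

theorem isQuantumLocallyCompactMetricSpace_of_totallyBounded {h : M.alg}
    (hh : StrictlyPositiveElement h) {μ : State A} (hμ : μ ∈ M.localStates)
    (hT : TotallyBounded ((fun a => incl A h * a * incl A h) '' L.ballAt μ)) :
    IsQuantumLocallyCompactMetricSpace L M := by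
  have hR := isRegular_of_totallyBounded hh hT
  have hT' : ∀ ν ∈ M.localStates,
      TotallyBounded ((fun a => incl A h * a * incl A h) '' L.ballAt ν) := fun ν hν =>
    totallyBounded_ballAt_change (nonempty_majorant hh) hR hμ hν hT
  refine ⟨hR, fun S hS => le_antisymm
    (induced_mono (LipschitzSeminorm.mkTopology_le_weakStarTopology L)) ?_⟩
  rw [← continuous_iff_le_induced]
  let _ := L.mkEMetric
  let tS : TopologicalSpace S := TopologicalSpace.induced ((↑) : S → State A) (weakStarTopology A)
  change Continuous ((↑) : S → State A)
  rw [continuous_iff_continuousAt]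
  intro φ
  refine EMetric.tendsto_nhds.2 fun ε hε => ?_
  obtain ⟨ε', hε', hlt⟩ := ENNReal.lt_iff_exists_real_btwn.1 hε
  have hε0 : 0 < ε' / 7 := by
    have : 0 < ε' := ENNReal.ofReal_pos.1 hlt.1
    positivity
  obtain ⟨F, δ, hδ, hF⟩ := exists_finset_of_isTame hh hT' hS φ.2 hε0
  have hw : Continuous fun (ψ : S) (a : A) => ψ.1.1 (incl A a) :=
    continuous_iff_le_induced.2 (le_of_eq induced_compose)
  have hc : ∀ c : A, Continuous fun ψ : S => ψ.1.1 (incl A c) := fun c =>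
    (continuous_apply c).comp hw
  have hev : ∀ᶠ ψ in 𝓝 φ, ∀ c ∈ F, ‖ψ.1.1 (incl A c) - φ.1.1 (incl A c)‖ < δ := by
    rw [Filter.eventually_all_finset]
    intro c _
    have := (hc c).continuousAt (x := φ)
    filter_upwards [Metric.tendsto_nhds.1 this δ hδ] with ψ hψ
    rwa [dist_eq_norm] at hψ
  filter_upwards [hev] with ψ hψ
  rw [edist_comm]
  refine lt_of_le_of_lt ?_ hlt.2
  change L.dist φ.1 ψ.1 ≤ _
  refine LipschitzSeminorm.dist_le_of_forall fun b hb => ?_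
  have := hF ψ.1 ψ.2 hψ b hb
  linarith

end Topography
end

/-! ### From the metric to total boundedness of compressions -/

noncomputable section

attribute [local instance] isClosed_minUnitization Topography.isClosed_alg

variable {A : Type*} [NonUnitalCStarAlgebra A] [PartialOrder A] [StarOrderedRing A]
  {L : LipschitzSeminorm A} {M : Topography A}

namespace Topography

variable {K : TopologicalSpace.Compacts M.spec}

/-- Once `K'` contains `K`, compressing by `1_{K'}` changes nothing, so the suprema are eventually
`0`. -/
theorem isTame_statesOn (hne : ∀ K, Nonempty (M.Majorant K)) {μ : State A}
    (hμ : μ ∈ M.localStates) (K : TopologicalSpace.Compacts M.spec) :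
    IsTame L M (M.statesOn K) := by
  refine ⟨μ, hμ, tendsto_const_nhds.congr' ?_⟩
  filter_upwards [Ici_mem_atTop K] with K' hK'
  refine (le_antisymm (iSup₂_le fun φ hφ => iSup₂_le fun a _ => ?_) zero_le).symm
  rw [corner_apply_of_mem (statesOn_mono hK' hφ), sub_self, enorm_zero]

/-- Banach-Alaoglu on `uA`. Taking the value `1` on majorants is a closed condition and prevents
mass from escaping `A` in the limit. -/
theorem isCompact_statesOn [Nonempty (M.Majorant K)] :
    @IsCompact _ (weakStarTopology A) (M.statesOn K) := by
  obtain ⟨g₀⟩ := ‹Nonempty (M.Majorant K)›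
  have : Nonempty (M.Majorant K) := ⟨g₀⟩
  let P : Set (WeakDual ℂ (MinUnitization A)) :=
    (WeakDual.toStrongDual ⁻¹' Metric.closedBall (0 : StrongDual ℂ (MinUnitization A)) 1) ∩
      ({φ | ∀ b, 0 ≤ φ (star b * b)} ∩ ({φ | φ 1 = 1} ∩
        {φ | ∀ g : M.Majorant K, φ (incl A g.1) = 1}))
  have hP : IsCompact P := by
    refine (WeakDual.isCompact_closedBall 0 1).inter_right
      (IsClosed.inter ?_ (IsClosed.inter ?_ ?_))
    · simp only [Set.ofPred_forall]
      exact isClosed_iInter fun b => isClosed_Ici.preimage (WeakDual.eval_continuous _)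
    · exact isClosed_eq (WeakDual.eval_continuous _) continuous_const
    · simp only [Set.ofPred_forall]
      exact isClosed_iInter fun g => isClosed_eq (WeakDual.eval_continuous _) continuous_const
  let F : P → State A := fun p => State.ofApplyEqOne (φ := WeakDual.toStrongDual p.1)
    p.2.2.1 p.2.2.2.1 ⟨g₀.1, g₀.2.2.1, p.2.2.2.2 g₀⟩
  let _ := weakStarTopology A
  have hF : Continuous F := continuous_induced_rng.2 (continuous_pi fun a =>
    (WeakDual.eval_continuous (incl A a)).comp continuous_subtype_val)
  have : CompactSpace P := isCompact_iff_compactSpace.1 hP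
  convert isCompact_range hF using 1
  ext φ
  constructor
  · intro hφ
    refine ⟨⟨StrongDual.toWeakDual φ.1, ?_, φ.2.1, φ.2.2.1, apply_majorant_eq_one hφ⟩, rfl⟩
    rw [Set.mem_preimage, mem_closedBall_zero_iff]
    refine ContinuousLinearMap.opNorm_le_bound _ zero_le_one fun b => ?_
    rw [one_mul]
    exact norm_apply_le φ.2.1 φ.2.2.1 b
  · rintro ⟨p, rfl⟩
    exact mem_statesOn_iff.2 p.2.2.2.2

/-- Tameness transports weak* compactness of `𝒮(A|K)` to the topology of `mk_L`, where compact sets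
are totally bounded. -/
theorem exists_finite_net (hne : ∀ K, Nonempty (M.Majorant K))
    (hQ : IsQuantumLocallyCompactMetricSpace L M) {μ : State A} (hμ : μ ∈ M.localStates)
    (K : TopologicalSpace.Compacts M.spec) {ε : ℝ} (hε : 0 < ε) :
    ∃ T : Finset (State A), (∀ φ ∈ T, φ ∈ M.statesOn K) ∧
      ∀ φ ∈ M.statesOn K, ∃ χ ∈ T, L.dist φ χ ≤ ENNReal.ofReal ε := by
  have h1 := (@isCompact_iff_compactSpace _ (weakStarTopology A) _).1 (isCompact_statesOn (K := K))
  have h2 : @CompactSpace (M.statesOn K)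
      (TopologicalSpace.induced ((↑) : M.statesOn K → State A) L.mkTopology) := by
    rw [hQ.2 _ (isTame_statesOn hne hμ K)]
    exact h1
  have h3 : @IsCompact _ L.mkTopology (M.statesOn K) :=
    (@isCompact_iff_compactSpace _ L.mkTopology _).2 h2
  let _ := L.mkEMetric
  obtain ⟨t, ht, hfin, hcov⟩ := EMetric.totallyBounded_iff'.1 h3.totallyBounded
    (ENNReal.ofReal ε) (ENNReal.ofReal_pos.2 hε)
  refine ⟨hfin.toFinset, fun φ hφ => ht (hfin.mem_toFinset.1 hφ), fun φ hφ => ?_⟩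
  obtain ⟨χ, hχ, h4⟩ := Set.mem_iUnion₂.1 (hcov hφ)
  exact ⟨χ, hfin.mem_toFinset.2 hχ, le_of_lt h4⟩

theorem totallyBounded_of_supportedIn [Nontrivial A] (hne : ∀ K, Nonempty (M.Majorant K))
    (hQ : IsQuantumLocallyCompactMetricSpace L M) {μ : State A} (hμ : μ ∈ M.localStates)
    {f : M.alg} (hf : IsSelfAdjoint f) (hfK : SupportedIn f K) :
    TotallyBounded ((fun a => incl A f * a * incl A f) '' L.ballAt μ) := by
  rw [Metric.totallyBounded_iff]
  intro ε hε
  -- The error on `𝒮(A|K)` will be `3δ`, and `3δ‖f‖² < ε`; the `1` covers `f = 0`.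
  set δ := ε / (4 * (1 + ‖f‖ ^ 2)) with hδ
  have hδ0 : 0 < δ := by positivity
  obtain ⟨T, hTK, hT⟩ := exists_finite_net hne hQ hμ K hδ0
  obtain ⟨c, hc, hcb⟩ := exists_dist_le hne hQ.1 hμ K
  let Φ : MinUnitization A → (T → ℂ) := fun a φ => φ.1.1 a
  have hΦ : TotallyBounded (Φ '' L.ballAt μ) := by
    refine TotallyBounded.subset ?_ (isCompact_closedBall (0 : T → ℂ) c).totallyBounded
    rintro _ ⟨a, ha, rfl⟩
    rw [mem_closedBall_zero_iff, pi_norm_le_iff_of_nonneg hc]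
    exact fun φ => LipschitzSeminorm.norm_le_of_mem_ballAt ha hc (hcb _ (hTK _ φ.2))
  obtain ⟨R, hRsub, hRfin, hR⟩ := Metric.finite_approx_of_totallyBounded hΦ δ hδ0
  have hchoose : ∀ z : T → ℂ, ∃ a, z ∈ R → a ∈ L.ballAt μ ∧ Φ a = z := fun z => by
    by_cases hz : z ∈ R
    · obtain ⟨a, ha, haz⟩ := hRsub hz
      exact ⟨a, fun _ => ⟨ha, haz⟩⟩
    · exact ⟨0, fun h => (hz h).elim⟩
  choose a ha using hchoose
  refine ⟨(fun z => incl A f * a z * incl A f) '' R, hRfin.image _, ?_⟩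
  rintro _ ⟨b, hb, rfl⟩
  obtain ⟨z, hz, hzb⟩ := Set.mem_iUnion₂.1 (hR ⟨b, hb, rfl⟩)
  obtain ⟨haz, haz'⟩ := ha z hz
  refine Set.mem_iUnion₂.2 ⟨_, ⟨z, hz, rfl⟩, ?_⟩
  rw [Metric.mem_ball, dist_eq_norm] at hzb ⊢
  rw [← haz'] at hzb
  have h1 : ∀ φ ∈ M.statesOn K, ‖φ.1 (b - a z)‖ ≤ 3 * δ := by
    intro φ hφ
    obtain ⟨χ, hχ, hd⟩ := hT φ hφ
    have h2 := LipschitzSeminorm.norm_sub_le_of_dist_le hb.1 hδ0.le hd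
    have h3 := LipschitzSeminorm.norm_sub_le_of_dist_le haz.1 hδ0.le hd
    have h4 : ‖χ.1 b - χ.1 (a z)‖ ≤ δ := (norm_le_pi_norm (Φ b - Φ (a z)) ⟨χ, hχ⟩).trans hzb.le
    have h5 : φ.1 (b - a z) = (φ.1 b - χ.1 b) - (φ.1 (a z) - χ.1 (a z)) + (χ.1 b - χ.1 (a z)) := by
      rw [map_sub]; ring
    rw [h5]
    calc _ ≤ _ := norm_add_le _ _
      _ ≤ _ := add_le_add_left (norm_sub_le _ _) _
      _ ≤ 3 * δ := by linarith
  have h2 := norm_mul_mul_le hf hfK ((LipschitzSeminorm.isSelfAdjoint_of_mem_unitBall hb.1).sub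
    (LipschitzSeminorm.isSelfAdjoint_of_mem_unitBall haz.1)) (by positivity) h1
  rw [mul_sub, sub_mul] at h2
  refine h2.trans_lt ?_
  have h3 : δ * (1 + ‖f‖ ^ 2) = ε / 4 := by
    rw [hδ]; field_simp
  nlinarith [sq_nonneg ‖f‖]

/-! ### Existence of strictly positive elements -/

section StrictlyPositive

omit [PartialOrder A] [StarOrderedRing A] in
theorem apply_mul_eq_zero {ψ : StrongDual ℂ M.alg} (hψ : ∀ m, 0 ≤ ψ (star m * m)) {k : M.alg}
    (hk : ψ (star k * k) = 0) (m : M.alg) : ψ (star k * m) = 0 := by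
  have h := IsPositiveFunctional.norm_sq_le (φ := ψ.toLinearMap) hψ k m
  change ‖ψ (star k * m)‖ ^ 2 ≤ (ψ (star k * k)).re * _ at h
  rw [hk, Complex.zero_re, zero_mul] at h
  exact norm_eq_zero.1 (pow_eq_zero_iff two_ne_zero |>.1 (le_antisymm h (by positivity)))

omit [PartialOrder A] [StarOrderedRing A] in
theorem eq_zero_of_star_mul_self {ψ : StrongDual ℂ M.alg} (hψ : ∀ m, 0 ≤ ψ (star m * m))
    (h0 : ∀ m, ψ (star m * m) = 0) : ψ = 0 := by
  have hs : ∀ s : M.alg, IsSelfAdjoint s → ψ s = 0 := by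
    intro s hs
    -- `M` may lack a unit, so `s` is factored as `√|s|` times the difference of the roots of its
    -- positive and negative parts, and Cauchy-Schwarz applies to the first factor.
    have hF : Continuous fun r : ℝ => √|r| := by fun_prop
    have hG : Continuous fun r : ℝ => √(max r 0) - √(max (-r) 0) := by fun_prop
    have e := cfcₙ_mul (fun r : ℝ => √|r|) (fun r : ℝ => √(max r 0) - √(max (-r) 0)) s
      hF.continuousOn (by simp) hG.continuousOn (by simp)
    have e2 : cfcₙ (fun r : ℝ => √|r| * (√(max r 0) - √(max (-r) 0))) s = s := by
      conv_rhs => rw [← cfcₙ_id' ℝ s]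
      refine cfcₙ_congr fun r _ => ?_
      rcases le_total 0 r with hr | hr
      · simp only [abs_of_nonneg hr, max_eq_left hr, max_eq_right (neg_nonpos.2 hr), Real.sqrt_zero,
          sub_zero, Real.mul_self_sqrt hr]
      · simp only [abs_of_nonpos hr, max_eq_right hr, max_eq_left (neg_nonneg.2 hr), Real.sqrt_zero,
          zero_sub, mul_neg, Real.mul_self_sqrt (neg_nonneg.2 hr), neg_neg]
    rw [← e2, e, ← (IsSelfAdjoint.cfcₙ (f := fun r : ℝ => √|r|) (a := s)).star_eq]
    exact apply_mul_eq_zero hψ (h0 _) _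
  ext m
  rw [← realPart_add_I_smul_imaginaryPart m, map_add, map_smul, hs _ (realPart m).2,
    hs _ (imaginaryPart m).2]
  simp

theorem strictlyPositiveElement_of_hasSum {f : ℕ → M.alg} (hf : ∀ n, 0 ≤ (f n : A)) {h : M.alg}
    (hs : HasSum f h)
    (hψ : ∀ ψ : StrongDual ℂ M.alg, (∀ m, 0 ≤ ψ (star m * m)) → (∀ n, ψ (f n) = 0) → ψ = 0) :
    StrictlyPositiveElement h := by
  have hA : HasSum (fun n => (f n : A)) h :=
    hs.map (AddSubmonoidClass.subtype M.alg) continuous_subtype_val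
  obtain ⟨k, hk⟩ := exists_eq_star_mul_self (hA.nonneg hf)
  refine ⟨⟨k, hk⟩, fun ψ hp h0 => ?_⟩
  have h1 : 0 ≤ ψ h := hk ▸ hp k
  refine lt_of_le_of_ne h1 fun h2 => h0 (hψ ψ hp ?_)
  have h3 : HasSum (fun n => (ψ (f n)).re) (ψ h).re := Complex.hasSum_re (hs.mapL ψ)
  have hn : ∀ n, 0 ≤ ψ (f n) := fun n => by
    obtain ⟨k, hk⟩ := exists_eq_star_mul_self (hf n)
    rw [hk]; exact hp k
  rw [← h2, Complex.zero_re, hasSum_zero_iff_of_nonneg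
    fun n => (Complex.nonneg_iff.1 (hn n)).1] at h3
  exact fun n => Complex.ext (congrFun h3 n) (Complex.nonneg_iff.1 (hn n)).2.symm

/-- Sum the squares `m⋆m` over a dense sequence with summable positive weights: a positive
functional vanishing at the sum vanishes at each term, hence at all squares. -/
theorem exists_strictlyPositiveElement [TopologicalSpace.SeparableSpace A] (M : Topography A) :
    ∃ h : M.alg, StrictlyPositiveElement h := by
  have : SecondCountableTopology A := UniformSpace.secondCountable_of_separable A
  have : TopologicalSpace.SeparableSpace M.alg := inferInstance
  let m := TopologicalSpace.denseSeq M.alg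
  let c : ℕ → ℝ := fun n => (1 / 2) ^ n / (1 + ‖m n‖ ^ 2)
  have hc : ∀ n, 0 < c n := fun n => by positivity
  have hsum : Summable fun n => (c n : ℂ) • (star (m n) * m n) := by
    refine Summable.of_norm_bounded (g := fun n => (1 / 2 : ℝ) ^ n) summable_geometric_two
      fun n => ?_
    rw [norm_smul, CStarRing.norm_star_mul_self, Complex.norm_real,
      Real.norm_of_nonneg (hc n).le, ← sq, div_mul_eq_mul_div]
    refine div_le_of_le_mul₀ (by positivity) (by positivity) ?_
    gcongr
    linarith
  refine ⟨_, strictlyPositiveElement_of_hasSum (fun n => ?_) hsum.hasSum fun ψ hψ h0 => ?_⟩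
  · change 0 ≤ (c n : ℂ) • (star (m n : A) * (m n : A))
    rw [Complex.coe_smul]
    exact smul_nonneg (hc n).le (star_mul_self_nonneg _)
  · refine eq_zero_of_star_mul_self hψ fun b => ?_
    have hcont : Continuous fun b : M.alg => ψ (star b * b) := by fun_prop
    refine congrFun (hcont.ext_on (TopologicalSpace.denseRange_denseSeq M.alg)
      (continuous_const (y := (0 : ℂ))) ?_) b
    rintro _ ⟨n, rfl⟩
    have := h0 n
    rw [map_smul, smul_eq_zero] at this
    exact this.resolve_left (Complex.ofReal_ne_zero.2 (hc n).ne')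

end StrictlyPositive

end Topography
end

/-! ### A strictly positive series of cutoffs -/

noncomputable section

attribute [local instance] isClosed_minUnitization Topography.isClosed_alg

namespace Topography

section SupportedIn

variable {A : Type*} [NonUnitalCStarAlgebra A] {M : Topography A}
  {K : TopologicalSpace.Compacts M.spec}

theorem SupportedIn.mono {f : M.alg} (hf : SupportedIn f K) {K' : TopologicalSpace.Compacts M.spec}
    (hK : K ≤ K') : SupportedIn f K' := fun x hx => hf x fun h => hx (hK h)

theorem SupportedIn.sum_smul {f : ℕ → M.alg} (c : ℕ → ℂ) {N : ℕ}
    (hf : ∀ n < N, SupportedIn (f n) K) : SupportedIn (∑ n ∈ Finset.range N, c n • f n) K := by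
  intro x hx
  rw [map_sum]
  refine Finset.sum_eq_zero fun n hn => ?_
  rw [map_smul, hf n (Finset.mem_range.1 hn) x hx, smul_zero]

end SupportedIn

section Construction

variable {A : Type*} [NonUnitalCStarAlgebra A] {M : Topography A}

/-- The `n`-th member of an increasing family of compactly supported functions of `h`. -/
abbrev cutoff (h : M.alg) (n : ℕ) : M.alg := rampOf h ((1 / 2) ^ (n + 1)) ((1 / 2) ^ n)

theorem half_pow_succ_lt (n : ℕ) : (1 / 2 : ℝ) ^ (n + 1) < (1 / 2) ^ n :=
  pow_lt_pow_right_of_lt_one₀ (by norm_num) (by norm_num) n.lt_succ_self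

theorem half_pow_pos (n : ℕ) : (0 : ℝ) < (1 / 2) ^ n := by positivity

variable {h : M.alg}

theorem cutoff_supportedIn (hh : IsSelfAdjoint h) {n N : ℕ} (hn : n < N) :
    SupportedIn (cutoff h n) (level h (half_pow_pos N)) :=
  (rampOf_supportedIn hh (half_pow_pos (n + 1)) (half_pow_succ_lt n)).mono
    (level_mono (half_pow_pos N) (pow_le_pow_of_le_one (by norm_num) (by norm_num) hn))

variable [PartialOrder A] [StarOrderedRing A]

theorem cutoff_mul_eq (hh : IsSelfAdjoint h) {N : ℕ} {f : M.alg}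
    (hf : SupportedIn f (level h (half_pow_pos N))) : cutoff h N * f = f :=
  (rampMajorant hh (half_pow_pos (N + 1)).le (half_pow_succ_lt N) fun _ hx => hx :
    M.Majorant (level h (half_pow_pos N))).mul_eq hf

omit [PartialOrder A] [StarOrderedRing A] in
theorem norm_cutoff_mul_sub_le (hh : StrictlyPositiveElement h) (n : ℕ) :
    ‖cutoff h n * h - h‖ ≤ (1 / 2) ^ n := by
  have hsa := StrictlyPositive.isSelfAdjoint hh
  -- Using `max r 0` for `r` is harmless since characters are positive at `h`, and it makes the
  -- bound valid for every real `r`.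
  have hF : Continuous fun r : ℝ =>
      (ramp ((1 / 2) ^ (n + 1)) ((1 / 2) ^ n) r - 1) * max r 0 :=
    (continuous_ramp.sub continuous_const).mul (by fun_prop)
  have e : cutoff h n * h - h =
      cfcₙ (fun r : ℝ => (ramp ((1 / 2) ^ (n + 1)) ((1 / 2) ^ n) r - 1) * max r 0) h := by
    refine eq_of_character_eq fun x => ?_
    have hx := re_character_pos hh x
    have hr : ((x h).re : ℂ) = x h := by
      rw [← Complex.conj_eq_iff_re, ← Complex.star_def, ← character_map_star, hsa.star_eq]
    have h1 : x (cutoff h n * h - h) = x (cutoff h n) * x h - x h := by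
      rw [← character_mul]; exact map_sub x _ _
    rw [h1, character_rampOf hsa (half_pow_pos _).le (half_pow_succ_lt n),
      character_cfcₙ x hsa hF (by simp), max_eq_left hx.le]
    push_cast
    rw [hr]
    ring
  rw [e]
  refine norm_cfcₙ_le fun r _ => ?_
  have h0 := ramp_nonneg (s := (1 / 2 : ℝ) ^ (n + 1)) (t := (1 / 2) ^ n) r
  have h1 := ramp_le_one (s := (1 / 2 : ℝ) ^ (n + 1)) (t := (1 / 2) ^ n) r
  rw [norm_mul, Real.norm_of_nonneg (le_max_right r 0), Real.norm_of_nonpos (by linarith)]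
  rcases le_total r ((1 / 2) ^ n) with hr | hr
  · have h2 : max r 0 ≤ (1 / 2) ^ n := max_le hr (half_pow_pos n).le
    have h3 : 0 ≤ max r 0 := le_max_right _ _
    nlinarith
  · rw [ramp_of_ge (half_pow_succ_lt n) hr]
    simp

/-- A positive functional killing every cutoff kills `cutoff h n * h`, which tends to `h`,
contradicting strict positivity of `h`. -/
theorem strictlyPositiveElement_of_hasSum_cutoff (hh : StrictlyPositiveElement h) {c : ℕ → ℝ}
    (hc : ∀ n, 0 < c n) {k : M.alg} (hk : HasSum (fun n => (c n : ℂ) • cutoff h n) k) :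
    StrictlyPositiveElement k := by
  have hpos : ∀ n, 0 ≤ (cutoff h n : A) := fun n =>
    rampOf_nonneg (half_pow_pos (n + 1)).le (half_pow_succ_lt n)
  refine strictlyPositiveElement_of_hasSum (fun n => ?_) hk fun ψ hψ h0 => ?_
  · change 0 ≤ (c n : ℂ) • (cutoff h n : A)
    rw [Complex.coe_smul]
    exact smul_nonneg (hc n).le (hpos n)
  · have h1 : ∀ n, ψ (cutoff h n * h) = 0 := fun n => by
      have := h0 n
      rw [map_smul, smul_eq_zero] at this
      have h2 := this.resolve_left (Complex.ofReal_ne_zero.2 (hc n).ne')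
      obtain ⟨m, hm⟩ := exists_eq_star_mul_self (hpos n)
      rw [hm] at h2 ⊢
      rw [mul_assoc]
      exact apply_mul_eq_zero hψ h2 _
    have h3 : Tendsto (fun n => cutoff h n * h) atTop (𝓝 h) :=
      tendsto_iff_norm_sub_tendsto_zero.2 (squeeze_zero (fun _ => norm_nonneg _)
        (norm_cutoff_mul_sub_le hh) (tendsto_pow_atTop_nhds_zero_of_lt_one (by norm_num)
          (by norm_num)))
    have h4 : ψ h = 0 :=
      tendsto_nhds_unique ((ψ.continuous.tendsto h).comp h3) (by
        simp only [Function.comp_def, h1]; exact tendsto_const_nhds)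
    by_contra hne
    exact (hh.2 ψ hψ hne).ne' h4

theorem exists_strictlyPositiveElement_totallyBounded [Nontrivial A] {L : LipschitzSeminorm A}
    (hh : StrictlyPositiveElement h) (hQ : IsQuantumLocallyCompactMetricSpace L M) {μ : State A}
    (hμ : μ ∈ M.localStates) : ∃ k : M.alg, StrictlyPositiveElement k ∧
      TotallyBounded ((fun a => incl A k * a * incl A k) '' L.ballAt μ) := by
  have hsa := StrictlyPositive.isSelfAdjoint hh
  have hne := nonempty_majorant hh
  have hT : ∀ n, TotallyBounded
      ((fun a => incl A (cutoff h n) * a * incl A (cutoff h n)) '' L.ballAt μ) := fun n =>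
    totallyBounded_of_supportedIn hne hQ hμ IsSelfAdjoint.cfcₙ
      (cutoff_supportedIn hsa n.lt_succ_self)
  choose C hC hCb using fun n => exists_norm_le_of_totallyBounded (hT n)
  -- The index is `n + 1` because cutoff `n + 1` is a unit for cutoff `n`, so `C (n + 1)` bounds the
  -- compressions involving the `n`-th term.
  let c : ℕ → ℝ := fun n => (1 / 2) ^ n / (1 + C (n + 1))
  have hC1 : ∀ n, 0 < 1 + C n := fun n => by linarith [hC n]
  have hc : ∀ n, 0 < c n := fun n => div_pos (half_pow_pos n) (hC1 _)
  have hc2 : ∀ n, c n ≤ (1 / 2) ^ n := fun n =>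
    div_le_self (half_pow_pos n).le (by linarith [hC (n + 1)])
  have hcC : ∀ n, c n * C (n + 1) ≤ (1 / 2) ^ n := fun n => by
    simp only [c]
    rw [div_mul_eq_mul_div, div_le_iff₀ (hC1 _)]
    nlinarith [half_pow_pos n, hC (n + 1)]
  have hnf : ∀ n, ‖(c n : ℂ) • cutoff h n‖ ≤ (1 / 2) ^ n := fun n => by
    rw [norm_smul, Complex.norm_real, Real.norm_of_nonneg (hc n).le]
    exact (mul_le_of_le_one_right (hc n).le norm_rampOf_le).trans (hc2 n)
  have hsum : Summable fun n => (c n : ℂ) • cutoff h n :=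
    Summable.of_norm_bounded summable_geometric_two hnf
  set k := ∑' n, (c n : ℂ) • cutoff h n
  let s : ℕ → M.alg := fun N => ∑ n ∈ Finset.range N, (c n : ℂ) • cutoff h n
  have hs : Tendsto s atTop (𝓝 k) := hsum.hasSum.tendsto_sum_nat
  have hsn : ∀ N, ‖s N‖ ≤ 2 := fun N => by
    refine (norm_sum_le_of_le _ fun n _ => hnf n).trans ?_
    exact (summable_geometric_two.sum_le_tsum _ fun n _ => (half_pow_pos n).le).trans
      tsum_geometric_two.le
  have hsS : ∀ N, SupportedIn (s N) (level h (half_pow_pos N)) := fun N =>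
    SupportedIn.sum_smul _ fun n hn => cutoff_supportedIn hsa hn
  let j : M.alg → MinUnitization A := fun m => incl A m
  have hjn : ∀ m, ‖j m‖ = ‖m‖ := fun m => (incl A).norm_map _
  have hunit : ∀ {N : ℕ} {f : M.alg}, SupportedIn f (level h (half_pow_pos N)) →
      j (cutoff h N) * j f = j f ∧ j f * j (cutoff h N) = j f := by
    intro N f hf
    have e : (cutoff h N : A) * (f : A) = f := congrArg (fun m : M.alg => (m : A))
      (cutoff_mul_eq hsa hf)
    refine ⟨by simp only [j]; rw [← incl_mul, e], ?_⟩
    simp only [j]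
    rw [← incl_mul, M.mul_comm _ f.2 _ (cutoff h N).2, e]
  have hsand : ∀ {N : ℕ} {f g : M.alg}, SupportedIn f (level h (half_pow_pos N)) →
      SupportedIn g (level h (half_pow_pos N)) → ∀ a : MinUnitization A,
      j f * a * j g = j f * (j (cutoff h N) * a * j (cutoff h N)) * j g := by
    intro N f g hf hg a
    calc j f * a * j g = (j f * j (cutoff h N)) * a * (j (cutoff h N) * j g) := by
          rw [(hunit hf).2, (hunit hg).1]
      _ = _ := by simp only [mul_assoc]
  have hsandn : ∀ {N : ℕ} {f g : M.alg}, SupportedIn f (level h (half_pow_pos N)) →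
      SupportedIn g (level h (half_pow_pos N)) → ∀ a ∈ L.ballAt μ,
      ‖j f * a * j g‖ ≤ ‖f‖ * C N * ‖g‖ := by
    intro N f g hf hg a ha
    rw [hsand hf hg]
    refine (norm_mul_le _ _).trans ?_
    rw [hjn]
    refine mul_le_mul_of_nonneg_right ((norm_mul_le _ _).trans ?_) (norm_nonneg _)
    rw [hjn]
    exact mul_le_mul_of_nonneg_left (hCb N _ ⟨a, ha, rfl⟩) (norm_nonneg _)
  -- Each of the two terms of the increment is at most `2 c_N C (N + 1)`. The form `8 / 2 / 2 ^ N`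
  -- of `4 / 2 ^ N` is the one summed by the geometric-series lemma.
  have hstep : ∀ a ∈ L.ballAt μ, ∀ N, dist (j (s N) * a * j (s N))
      (j (s (N + 1)) * a * j (s (N + 1))) ≤ 8 / 2 / 2 ^ N := by
    intro a ha N
    have hS1 := cutoff_supportedIn hsa N.lt_succ_self
    have hS2 := (hsS N).mono (level_mono (h := h) (half_pow_pos (N + 1)) (half_pow_succ_lt N).le)
    have e1 : j (s (N + 1)) = j (s N) + (c N : ℂ) • j (cutoff h N) := by
      simp only [j, s, Finset.sum_range_succ]
      rw [← map_smul, ← map_add]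
      rfl
    have e2 : j (s (N + 1)) * a * j (s (N + 1)) - j (s N) * a * j (s N) =
        (c N : ℂ) • (j (cutoff h N) * a * j (s (N + 1)) + j (s N) * a * j (cutoff h N)) := by
      conv_lhs => rw [e1]
      rw [e1]
      simp only [add_mul, mul_add, smul_mul_assoc, mul_smul_comm, smul_add]
      abel
    have n1 := hsandn hS1 (hsS (N + 1)) a ha
    have n2 := hsandn hS2 hS1 a ha
    have hf1 : ‖cutoff h N‖ ≤ 1 := norm_rampOf_le
    have n3 : ‖cutoff h N‖ * C (N + 1) * ‖s (N + 1)‖ ≤ 1 * C (N + 1) * 2 := by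
      have := hC (N + 1)
      gcongr
      exact hsn _
    have n4 : ‖s N‖ * C (N + 1) * ‖cutoff h N‖ ≤ 2 * C (N + 1) * 1 := by
      have := hC (N + 1)
      gcongr
      exact hsn _
    rw [dist_comm, dist_eq_norm, e2, norm_smul, Complex.norm_real, Real.norm_of_nonneg (hc N).le]
    have n5 : ‖j (cutoff h N) * a * j (s (N + 1)) + j (s N) * a * j (cutoff h N)‖ ≤
        4 * C (N + 1) := (norm_add_le _ _).trans (by linarith)
    calc _ ≤ c N * (4 * C (N + 1)) := mul_le_mul_of_nonneg_left n5 (hc N).le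
      _ = 4 * (c N * C (N + 1)) := by ring
      _ ≤ 4 * (1 / 2) ^ N := by linarith [hcC N]
      _ = 8 / 2 / 2 ^ N := by rw [one_div, inv_pow]; ring
  have hlim : ∀ a : MinUnitization A, Tendsto (fun N => j (s N) * a * j (s N)) atTop
      (𝓝 (j k * a * j k)) := fun a => by
    have h1 : Tendsto (fun N => j (s N)) atTop (𝓝 (j k)) :=
      (((incl A).continuous.comp continuous_subtype_val).tendsto k).comp hs
    exact (h1.mul_const a).mul h1
  have hdist : ∀ a ∈ L.ballAt μ, ∀ N, dist (j (s N) * a * j (s N)) (j k * a * j k) ≤ 8 / 2 ^ N :=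
    fun a ha N => dist_le_of_le_geometric_two_of_tendsto (hstep a ha) (hlim a) N
  refine ⟨k, strictlyPositiveElement_of_hasSum_cutoff hh hc hsum.hasSum, ?_⟩
  rw [Metric.totallyBounded_iff]
  intro ε hε
  obtain ⟨N, hN⟩ : ∃ N : ℕ, (8 : ℝ) / 2 ^ N < ε / 2 := by
    obtain ⟨N, hN⟩ := exists_pow_lt_of_lt_one (by positivity : 0 < ε / 16)
      (by norm_num : (1 / 2 : ℝ) < 1)
    refine ⟨N, ?_⟩
    rw [one_div, inv_pow] at hN
    rw [div_eq_mul_inv]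
    linarith
  have hTN : TotallyBounded ((fun a => j (s N) * a * j (s N)) '' L.ballAt μ) := by
    have := totallyBounded_image_mul_mul (hT N) (j (s N)) (j (s N))
    rw [Set.image_image] at this
    refine this.subset (Eq.subset (Set.image_congr fun a _ => ?_))
    exact hsand (hsS N) (hsS N) a
  obtain ⟨t, htfin, ht⟩ := Metric.totallyBounded_iff.1 hTN (ε / 2) (half_pos hε)
  refine ⟨t, htfin, ?_⟩
  rintro _ ⟨a, ha, rfl⟩
  obtain ⟨z, hz, haz⟩ := Set.mem_iUnion₂.1 (ht ⟨a, ha, rfl⟩)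
  refine Set.mem_iUnion₂.2 ⟨z, hz, ?_⟩
  rw [Metric.mem_ball] at haz ⊢
  have h1 := hdist a ha N
  rw [dist_comm] at h1
  calc _ ≤ dist (j k * a * j k) (j (s N) * a * j (s N)) + dist (j (s N) * a * j (s N)) z :=
        dist_triangle _ _ _
    _ < ε := by linarith

end Construction

end Topography
end

end QuantumLCMS

/-! ### The equivalence -/

theorem mainTheorem3 {A : Type*} [NonUnitalCStarAlgebra A] [PartialOrder A] [StarOrderedRing A]
    [Nontrivial A] [TopologicalSpace.SeparableSpace A]
    (L : QuantumLCMS.LipschitzSeminorm A) (M : QuantumLCMS.Topography A) :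
    List.TFAE [
      QuantumLCMS.IsQuantumLocallyCompactSeparableMetricSpace L M,
      ∃ h : M.alg, QuantumLCMS.StrictlyPositiveElement h ∧ ∀ μ ∈ M.localStates,
        TotallyBounded ((fun a => QuantumLCMS.incl A h * a * QuantumLCMS.incl A h) '' L.ballAt μ),
      ∃ h : M.alg, QuantumLCMS.StrictlyPositiveElement h ∧ ∃ μ ∈ M.localStates,
        TotallyBounded ((fun a => QuantumLCMS.incl A h * a * QuantumLCMS.incl A h) '' L.ballAt μ)] := by
  obtain ⟨μ, hμ⟩ := M.exists_mem_localStates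
  tfae_have 1 → 2 := fun hQ => by
    obtain ⟨h, hh⟩ := M.exists_strictlyPositiveElement
    obtain ⟨k, hk, hT⟩ :=
      QuantumLCMS.Topography.exists_strictlyPositiveElement_totallyBounded hh hQ.1 hμ
    exact ⟨k, hk, fun ν hν => QuantumLCMS.Topography.totallyBounded_ballAt_change
      (QuantumLCMS.Topography.nonempty_majorant hk) hQ.1.1 hμ hν hT⟩
  tfae_have 2 → 3 := fun ⟨h, hh, hT⟩ => ⟨h, hh, μ, hμ, hT μ hμ⟩
  tfae_have 3 → 1 := fun ⟨h, hh, ν, hν, hT⟩ =>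
    ⟨QuantumLCMS.Topography.isQuantumLocallyCompactMetricSpace_of_totallyBounded hh hν hT,
      inferInstance⟩
  tfae_finish
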